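/- All partially ordered vector spaces are real and Archimedean. A \emph{Riesz algebra} is an associative algebra that is a Riesz space in which products of positive elements are positive; a \emph{Riesz subalgebra} is a subalgebra that is also a vector sublattice; a \emph{Riesz algebra homomorphism} is an algebra homomorphism (not necessarily unital) that is also a vector lattice homomorphism. A positive operator $T$ is \emph{order continuous} (resp.\ \emph{$\sigma$-order continuous}) when $Tx_\lambda\downarrow 0$ for every net $x_\lambda\downarrow 0$ (resp.\ for every sequence). A \emph{$\sigma$-order ideal} is an order ideal that is closed under existing suprema of countable subsets. A partially ordered vector space is \emph{monotone complete} when every increasing net that is bounded from above has a supremum; it has the \emph{countable sup property} when every net $(x_\lambda)$ of positive elements with $x_\lambda\uparrow x$ admits indices $\lambda_1,\lambda_2,\dots$ with $x=\sup_n x_{\lambda_n}$. Let $(X,\Omega)$ be a measurable space, and let $A$ be a $\sigma$-Dedekind complete Riesz algebra with a positive identity element $e$ and with $\sigma$-monotone continuous multiplication, i.e., whenever $a_n,a,b\in A^+$ and $a_n\uparrow a$, then $ba_n\uparrow ba$ and $a_nb\uparrow ab$. Let $\mu:\Omega\to A^+$ be a finite spectral measure, that is, $\mu(\emptyset)=0$,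 $\mu\bigl(\bigcup_n A_n\bigr)=\sup_N\sum_{n=1}^N\mu(A_n)$ for every pairwise disjoint sequence $(A_n)$ in $\Omega$, and $\mu(A_1\cap A_2)=\mu(A_1)\mu(A_2)$ for all $A_1,A_2\in\Omega$. Suppose that $\mu(X)\leq e$. For an elementary function $\varphi=\sum_{i=1}^n r_i\chi_{A_i}$ with $r_i\in[0,\infty)$ and pairwise disjoint $A_i\in\Omega$, put $\int\varphi\,d\mu=\sum_i r_i\mu(A_i)$. For a measurable $f:X\to[0,\infty)$, the order integral $\int f\,d\mu$ is the supremum of $\int\varphi_n\,d\mu$ for any sequence of elementary functions $\varphi_n\uparrow f$ pointwise; it is finite when this supremum exists in $A$. Let $\mathcal L^1$ be the set of measurable $f:X\to\mathbb R$ for which $\int|f|\,d\mu$ is finite, and for $f\in\mathcal L^1$ let $I_\mu(f)=\int f^+\,d\mu-\int f^-\,d\mu$. Let $\mathcal N\subseteq\mathcal L^1$ be the subset of functions that vanish $\mu$-almost everywhere, let $L^1=\mathcal L^1/\mathcal N$, and let $\mathcal B$ be the set of bounded measurable functions on $X$. Then: \begin{enumerate} \item $\mu(X)A\mu(X)$ is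 a Riesz subalgebra of $A$ that is also a projection band in $A$. \item $\mathcal L^1$ is a unital Riesz algebra (with pointwise operations and ordering), and $I_\mu:\mathcal L^1\to A$ is a well defined Riesz algebra homomorphism. \item The image of $I_\mu$ is contained in $\mu(X)A\mu(X)$. Moreover: (a) $\mathcal B\subseteq\mathcal L^1$, and $I_\mu(\mathcal B)$ is contained in the order ideal of $\mu(X)A\mu(X)$ that is generated by $\mu(X)$; (b) $I_\mu(\mathcal L^1)$ is contained in the $\sigma$-order ideal of $\mu(X)A\mu(X)$ that is generated by $\mu(X)$. \item The kernel of $I_\mu:\mathcal L^1\to A$ is $\mathcal N$, and $L^1$ is a commutative unital Riesz algebra. The induced map $I_\mu:L^1\to A$ is an injective Riesz algebra homomorphism (hence a Riesz algebra isomorphism onto its image). The space $L^1$ is $\sigma$-Dedekind complete, and $I_\mu:L^1\to A$ and $I_\mu:L^1\to\mu(X)A\mu(X)$ are both $\sigma$-order continuous. When, in addition, $A$ is monotone complete and has the countable sup property, then $L^1$ is Dedekind complete, it has the countable sup property, and $I_\mu:L^1\to A$ and $I_\mu:L^1\to\mu(X)A\mu(X)$ are both order continuous. \end{enumerate} -/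

import Mathlib

open Set Filter Topology
open scoped NNReal

universe u v

/-! ### Completeness and continuity notions in partially ordered vector spaces -/

section Order

variable (E : Type u) [PartialOrder E]

/-- Every non-empty, at most countable subset that is bounded from above has a supremum. -/
def SigmaDedekindComplete : Prop :=
  ∀ S : Set E, S.Nonempty → S.Countable → BddAbove S → ∃ a, IsLUB S a

/-- Every non-empty subset that is bounded from above has a supremum. -/
def DedekindComplete : Prop :=
  ∀ S : Set E, S.Nonempty → BddAbove S → ∃ a, IsLUB S a

/-- Every increasing net that is bounded from above has a supremum. (Index sets in the universe
of `E` suffice, since the range of an increasing net is an increasing net indexed by itself.) -/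
def MonotoneComplete : Prop :=
  ∀ (ι : Type u) [Preorder ι] [IsDirectedOrder ι] [Nonempty ι] (x : ι → E),
    Monotone x → BddAbove (range x) → ∃ a, IsLUB (range x) a

/-- For every net `x` in the positive cone with `x ↑ a` there are countably many indices along
which the supremum is already attained. -/
def CountableSupProperty [Zero E] : Prop :=
  ∀ (ι : Type u) [Preorder ι] [IsDirectedOrder ι] [Nonempty ι] (x : ι → E) (a : E),
    (∀ i, 0 ≤ x i) → Monotone x → IsLUB (range x) a →
      ∃ s : ℕ → ι, IsLUB (range fun n => x (s n)) a

/-- Left and right multiplications by positive elements preserve the suprema of increasing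
sequences of positive elements. -/
def SigmaMonotoneContinuousMul [NonUnitalRing E] : Prop :=
  ∀ (x : ℕ → E) (a : E), (∀ n, 0 ≤ x n) → 0 ≤ a → Monotone x → IsLUB (range x) a →
    ∀ b : E, 0 ≤ b →
      (Monotone fun n => b * x n) ∧ IsLUB (range fun n => b * x n) (b * a) ∧
      (Monotone fun n => x n * b) ∧ IsLUB (range fun n => x n * b) (a * b)

end Order

section Operators

variable {E : Type u} {F : Type v} [AddCommGroup E] [Module ℝ E] [PartialOrder E]
  [AddCommGroup F] [Module ℝ F] [PartialOrder F]

/-- A positive operator `T` such that `x ↓ 0` implies `T x ↓ 0` for sequences `x`. -/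
def IsSigmaOrderContinuous (T : E →ₗ[ℝ] F) : Prop :=
  (∀ x, 0 ≤ x → 0 ≤ T x) ∧
  ∀ x : ℕ → E, Antitone x → IsGLB (range x) 0 →
    (Antitone fun n => T (x n)) ∧ IsGLB (range fun n => T (x n)) 0

/-- A positive operator `T` such that `x ↓ 0` implies `T x ↓ 0` for nets `x`. -/
def IsOrderContinuous (T : E →ₗ[ℝ] F) : Prop :=
  (∀ x, 0 ≤ x → 0 ≤ T x) ∧
  ∀ (ι : Type u) [Preorder ι] [IsDirectedOrder ι] [Nonempty ι] (x : ι → E),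
    Antitone x → IsGLB (range x) 0 →
      (Antitone fun i => T (x i)) ∧ IsGLB (range fun i => T (x i)) 0

end Operators

/-! ### Order ideals and bands in Riesz spaces -/

section Ideals

variable {E : Type u} [AddCommGroup E] [Module ℝ E] [Lattice E]

/-- A linear subspace `I` such that `|y| ≤ |x|` and `x ∈ I` imply `y ∈ I`. -/
def IsOrderIdeal (I : Submodule ℝ E) : Prop :=
  LatticeOrderedAddCommGroup.IsSolid (I : Set E)

/-- An order ideal that is closed under existing suprema of countable subsets. -/
def IsSigmaOrderIdeal (I : Submodule ℝ E) : Prop :=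
  IsOrderIdeal I ∧
    ∀ S : Set E, S ⊆ I → S.Nonempty → S.Countable → ∀ a, IsLUB S a → a ∈ I

/-- The smallest order ideal that contains `S`. -/
def orderIdealSpan (S : Set E) : Submodule ℝ E :=
  sInf {I | IsOrderIdeal I ∧ S ⊆ I}

/-- The smallest `σ`-order ideal that contains `S`. -/
def sigmaOrderIdealSpan (S : Set E) : Submodule ℝ E :=
  sInf {I | IsSigmaOrderIdeal I ∧ S ⊆ I}

/-- An order ideal that is closed under existing suprema. -/
def IsBand (B : Submodule ℝ E) : Prop :=
  IsOrderIdeal B ∧ ∀ S : Set E, S ⊆ B → S.Nonempty → ∀ a, IsLUB S a → a ∈ B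

/-- A band `B` such that every element is the sum of an element of `B` and an element of the
disjoint complement of `B`. -/
def IsProjectionBand (B : Submodule ℝ E) : Prop :=
  IsBand B ∧ ∀ x : E, ∃ b ∈ B, ∃ c : E, (∀ d ∈ B, |c| ⊓ |d| = 0) ∧ x = b + c

end Ideals

/-! ### Riesz algebras, Riesz subalgebras, Riesz algebra homomorphisms -/

/-- An associative real algebra that is an Archimedean Riesz space in which products of positive
elements are positive. There need not be an identity element. -/
structure IsRieszAlgebra (A : Type u) [NonUnitalRing A] [Module ℝ A] [Lattice A] : Prop where
  smul_mul_assoc : ∀ (r : ℝ) (a b : A), (r • a) * b = r • (a * b)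
  mul_smul_comm : ∀ (r : ℝ) (a b : A), a * (r • b) = r • (a * b)
  add_le_add_left : ∀ a b : A, a ≤ b → ∀ c : A, c + a ≤ c + b
  smul_nonneg : ∀ (r : ℝ) (a : A), 0 ≤ r → 0 ≤ a → 0 ≤ r • a
  mul_nonneg : ∀ a b : A, 0 ≤ a → 0 ≤ b → 0 ≤ a * b
  archimedean : ∀ a : A, 0 ≤ a → ∀ r : ℕ → ℝ, Antitone r → IsGLB (range r) 0 →
    IsGLB (range fun n => r n • a) 0

/-- A (not necessarily unital) subalgebra that is also a vector sublattice. -/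
structure RieszSubalgebra (A : Type u) [NonUnitalRing A] [Module ℝ A] [Lattice A]
    extends NonUnitalSubalgebra ℝ A where
  sup_mem' : ∀ {a b : A}, a ∈ carrier → b ∈ carrier → a ⊔ b ∈ carrier
  inf_mem' : ∀ {a b : A}, a ∈ carrier → b ∈ carrier → a ⊓ b ∈ carrier

namespace RieszSubalgebra

variable {A : Type u} [NonUnitalRing A] [Module ℝ A] [Lattice A]

instance : SetLike (RieszSubalgebra A) A where
  coe B := B.carrier
  coe_injective := by
    rintro ⟨B, _, _⟩ ⟨C, _, _⟩ h
    have : B = C := SetLike.coe_injective h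
    subst this
    rfl

instance : NonUnitalSubringClass (RieszSubalgebra A) A where
  add_mem {B} := B.add_mem'
  zero_mem {B} := B.zero_mem'
  mul_mem {B} := B.mul_mem'
  neg_mem {B} _ ha := neg_mem (S := NonUnitalSubalgebra ℝ A) (s := B.toNonUnitalSubalgebra) ha

instance : SMulMemClass (RieszSubalgebra A) ℝ A where
  smul_mem {B} r _ ha := B.smul_mem' r ha

/-- A Riesz subalgebra carries the lattice structure of the ambient Riesz algebra. -/
instance (B : RieszSubalgebra A) : Lattice B :=
  Subtype.lattice (P := fun a => a ∈ B) (fun _ _ ha hb => B.sup_mem' ha hb)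
    (fun _ _ ha hb => B.inf_mem' ha hb)

end RieszSubalgebra

/-- A linear map that is both an algebra homomorphism and a vector lattice homomorphism. -/
structure IsRieszAlgebraHom {A : Type u} {B : Type v} [NonUnitalRing A] [Module ℝ A] [Lattice A]
    [NonUnitalRing B] [Module ℝ B] [Lattice B] (T : A →ₗ[ℝ] B) : Prop where
  map_mul : ∀ a b, T (a * b) = T a * T b
  map_sup : ∀ a b, T (a ⊔ b) = T a ⊔ T b
  map_inf : ∀ a b, T (a ⊓ b) = T a ⊓ T b

/-! ### Finite measures with values in the positive cone, and the order integral -/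

/-- A finite measure on the `σ`-algebra of `X` with values in the positive cone of `E`. The values
of the underlying function at non-measurable sets play no role. -/
structure FiniteOrderMeasure (X : Type v) [MeasurableSpace X] (E : Type u) [AddCommGroup E]
    [PartialOrder E] where
  toFun : Set X → E
  nonneg' : ∀ s, MeasurableSet s → 0 ≤ toFun s
  empty' : toFun ∅ = 0
  iUnion' : ∀ s : ℕ → Set X, (∀ n, MeasurableSet (s n)) → Pairwise (fun i j => Disjoint (s i) (s j)) →
    IsLUB (range fun N : ℕ => ∑ n ∈ Finset.range N, toFun (s n)) (toFun (⋃ n, s n))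

namespace FiniteOrderMeasure

section

variable {X : Type v} [MeasurableSpace X] {E : Type u} [AddCommGroup E] [PartialOrder E]

instance : CoeFun (FiniteOrderMeasure X E) (fun _ => Set X → E) := ⟨toFun⟩

theorem union_eq_add (μ : FiniteOrderMeasure X E) [IsOrderedAddMonoid E] {s t : Set X}
    (hs : MeasurableSet s) (ht : MeasurableSet t) (hst : Disjoint s t) : μ (s ∪ t) = μ s + μ t := by
  let f : ℕ → Set X := fun n => if n = 0 then s else if n = 1 then t else ∅
  have hf : ∀ n, MeasurableSet (f n) := by
    intro n; dsimp only [f]; split_ifs <;> simp [hs, ht]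
  have hd : Pairwise (fun i j => Disjoint (f i) (f j)) := by
    intro i j hij
    dsimp only [f]
    split_ifs <;> simp_all [disjoint_comm]
  have hU : (⋃ n, f n) = s ∪ t := by
    ext x
    simp only [mem_iUnion, mem_union, f]
    constructor
    · rintro ⟨n, hn⟩
      split_ifs at hn <;> simp_all
    · rintro (h | h)
      · exact ⟨0, by simpa using h⟩
      · exact ⟨1, by simpa using h⟩
  have h := μ.iUnion' f hf hd
  rw [hU] at h
  have hsum : ∀ N, ∑ n ∈ Finset.range (N + 2), μ (f n) = μ s + μ t := by
    intro N
    induction N with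
    | zero => simp [Finset.sum_range_succ, f]
    | succ k ih =>
      rw [show k + 1 + 2 = (k + 2) + 1 from rfl, Finset.sum_range_succ, ih]
      simp [f, μ.empty']
  refine h.unique ⟨?_, fun b hb => ?_⟩
  · rintro _ ⟨N, rfl⟩
    rw [← hsum N]
    exact Finset.sum_le_sum_of_subset_of_nonneg (Finset.range_mono (by omega))
      (fun i _ _ => μ.nonneg' _ (hf i))
  · rw [← hsum 0]
    exact hb ⟨2, rfl⟩

theorem null_union (μ : FiniteOrderMeasure X E) [IsOrderedAddMonoid E] {s t : Set X}
    (hs : MeasurableSet s) (ht : MeasurableSet t) (hs0 : μ s = 0) (ht0 : μ t = 0) :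
    μ (s ∪ t) = 0 := by
  have h1 := μ.union_eq_add hs (ht.diff hs) disjoint_sdiff_right
  have h2 := μ.union_eq_add (ht.inter hs) (ht.diff hs) disjoint_inf_sdiff
  rw [inter_union_sdiff, ht0] at h2
  have h3 := μ.nonneg' _ (ht.inter hs)
  have h4 := μ.nonneg' _ (ht.diff hs)
  have h5 : μ (t \ s) = 0 := le_antisymm (by rw [h2]; exact le_add_of_nonneg_left h3) h4
  rw [union_sdiff_self] at h1
  rw [h1, hs0, h5, add_zero]

/-- The filter of all sets whose complement is contained in a measurable set of measure zero:
a property holds `μ`-almost everywhere when it holds eventually along this filter. -/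
def ae (μ : FiniteOrderMeasure X E) [IsOrderedAddMonoid E] : Filter X where
  sets := {s | ∃ t, MeasurableSet t ∧ μ t = 0 ∧ sᶜ ⊆ t}
  univ_sets := ⟨∅, MeasurableSet.empty, μ.empty', by simp⟩
  sets_of_superset := by
    rintro s s' ⟨t, ht, h0, hst⟩ hss
    exact ⟨t, ht, h0, (compl_subset_compl.2 hss).trans hst⟩
  inter_sets := by
    rintro s s' ⟨t, ht, h0, hst⟩ ⟨t', ht', h0', hst'⟩
    exact ⟨t ∪ t', ht.union ht', μ.null_union ht ht' h0 h0', by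
      rw [compl_inter]; exact union_subset_union hst hst'⟩

variable [Module ℝ E]

/-- The integral `∑ r • μ {φ = r}` of an elementary function `φ`, i.e. of a measurable function
with finitely many values in `[0, ∞)`. -/
noncomputable def elementaryIntegral (μ : FiniteOrderMeasure X E) (φ : MeasureTheory.SimpleFunc X ℝ≥0) : E :=
  ∑ r ∈ φ.range, (r : ℝ) • μ (φ ⁻¹' {r})

/-- The measurable function `f : X → [0, ∞)` has finite order integral `a`: there is a sequence of
elementary functions that increases pointwise to `f` and whose integrals have supremum `a`. -/
def HasPosIntegral (μ : FiniteOrderMeasure X E) (f : X → ℝ) (a : E) : Prop :=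
  ∃ φ : ℕ → MeasureTheory.SimpleFunc X ℝ≥0, (∀ x, Monotone fun n => φ n x) ∧
    (∀ x, Tendsto (fun n => (φ n x : ℝ)) atTop (𝓝 (f x))) ∧
    IsLUB (range fun n => μ.elementaryIntegral (φ n)) a

/-- Membership of the space `𝓛¹` of integrable functions: `f` is measurable and `|f|` has finite
order integral. -/
def Integrable (μ : FiniteOrderMeasure X E) (f : X → ℝ) : Prop :=
  Measurable f ∧ ∃ a, μ.HasPosIntegral |f| a

/-- The order integral of `f` is `a`, where the integral of `f` is defined by splitting `f` into
its positive and negative parts. -/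
def HasIntegral (μ : FiniteOrderMeasure X E) (f : X → ℝ) (a : E) : Prop :=
  ∃ b c, μ.HasPosIntegral f⁺ b ∧ μ.HasPosIntegral f⁻ c ∧ a = b - c

end

/-- A finite spectral measure: a finite algebra-valued measure with `μ (s ∩ t) = μ s * μ t`. -/
def IsSpectral {X : Type v} [MeasurableSpace X] {A : Type u} [NonUnitalRing A] [PartialOrder A]
    (μ : FiniteOrderMeasure X A) : Prop :=
  ∀ s t, MeasurableSet s → MeasurableSet t → μ (s ∩ t) = μ s * μ t

end FiniteOrderMeasure

/-! ### Suprema in partially ordered vector spaces -/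

section Suprema

variable {E : Type*} [AddCommGroup E] [PartialOrder E] [IsOrderedAddMonoid E]

/-! On elementary functions the integral is additive and positive, and spectrality makes it
multiplicative. Everything rests on one comparison, `IsSpectral.elementaryIntegral_le`: if `φ` is
elementary and the elementary `ψ n` increase to something at least `φ`, then every upper bound of
the `∫ ψ n` bounds `∫ φ`. For `c < 1` the sets `{c φ ≤ ψ n}` increase to `X`. Integrating `c φ` over
such a set amounts to multiplying `c ∫ φ` by the measure of the set, so σ-monotone continuity of the
multiplication yields `c ∫ φ`, and the Archimedean property lets `c` tend to `1`. Independence of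
the approximating sequence, monotonicity and monotone convergence all follow.

The integral is a lattice homomorphism because functions with disjoint supports have disjoint
integrals (`HasPosIntegral.inf_eq_zero`): the infimum of the integrals is annihilated by `μ s`, `μ
sᶜ` and `1 - μ univ`, which add up to `1`. Hence `|∫ f| = ∫ |f|`, and Chebyshev's inequality
identifies the kernel with the null functions.

The space `L¹` sits inside the germs along `μ.ae`, a filter closed under countable intersections.
Countable suprema and infima can therefore be formed pointwise off one null set, which gives
σ-Dedekind completeness and, with monotone convergence, σ-order continuity. The statements about
nets need no further measure theory: an injective σ-order continuous lattice homomorphism into a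
monotone complete space with the countable sup property reduces them to sequences
(`exists_isLUB_range_of_embedding`).

The corner is handled separately: with `p = μ univ` and `0 ≤ p ≤ 1`, the map `a ↦ p * a * p` is a
positive projection below the identity on the positive cone, hence a band projection. -/

theorem isLUB_range_add {x y : ℕ → E} {a b : E} (hx : Monotone x) (hy : Monotone y)
    (ha : IsLUB (range x) a) (hb : IsLUB (range y) b) :
    IsLUB (range fun n => x n + y n) (a + b) := by
  constructor
  · rintro _ ⟨n, rfl⟩
    exact add_le_add (ha.1 ⟨n, rfl⟩) (hb.1 ⟨n, rfl⟩)
  · intro c hc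
    -- Monotonicity decouples the two indices, so that the suprema can be taken one at a time.
    have h1 : ∀ n m, x n + y m ≤ c := fun n m =>
      (add_le_add (hx (le_max_left n m)) (hy (le_max_right n m))).trans (hc ⟨max n m, rfl⟩)
    have h2 : ∀ m, a ≤ c - y m := fun m => ha.2 (by
      rintro _ ⟨n, rfl⟩
      exact le_sub_iff_add_le.2 (h1 n m))
    have h3 : b ≤ c - a := hb.2 (by
      rintro _ ⟨m, rfl⟩
      exact le_sub_comm.1 (h2 m))
    rw [add_comm]
    exact le_sub_iff_add_le.1 h3

theorem IsGLB.isLUB_range_sub {ι : Type*} {x : ι → E} {a : E} (h : IsGLB (range x) a) (b : E) :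
    IsLUB (range fun i => b - x i) (b - a) := by
  refine ⟨?_, fun c hc => ?_⟩
  · rintro _ ⟨i, rfl⟩
    exact sub_le_sub_left (h.1 ⟨i, rfl⟩) b
  · refine sub_le_comm.1 (h.2 ?_)
    rintro _ ⟨i, rfl⟩
    exact sub_le_comm.1 (hc ⟨i, rfl⟩)

theorem IsLUB.isGLB_range_sub {ι : Type*} {x : ι → E} {a : E} (h : IsLUB (range x) a) (b : E) :
    IsGLB (range fun i => b - x i) (b - a) := by
  refine ⟨?_, fun c hc => ?_⟩
  · rintro _ ⟨i, rfl⟩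
    exact sub_le_sub_left (h.1 ⟨i, rfl⟩) b
  · refine le_sub_comm.1 (h.2 ?_)
    rintro _ ⟨i, rfl⟩
    exact le_sub_comm.1 (hc ⟨i, rfl⟩)

end Suprema

theorem isLUB_range_smul {E : Type*} [AddCommGroup E] [PartialOrder E] [Module ℝ E] [PosSMulMono ℝ E]
    {ι : Type*} [Nonempty ι] {x : ι → E} {a : E} {r : ℝ} (hr : 0 ≤ r) (ha : IsLUB (range x) a) : IsLUB (range fun n => r • x n) (r • a) := by
  rcases hr.eq_or_lt with rfl | hr
  · simp
  · constructor
    · rintro _ ⟨n, rfl⟩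
      exact smul_le_smul_of_nonneg_left (ha.1 ⟨n, rfl⟩) hr.le
    · intro c hc
      rw [← le_inv_smul_iff_of_pos hr]
      refine ha.2 ?_
      rintro _ ⟨n, rfl⟩
      exact (le_inv_smul_iff_of_pos hr).2 (hc ⟨n, rfl⟩)

section Archimedean

variable {E : Type*} [AddCommGroup E] [Lattice E] [IsOrderedAddMonoid E]

/-- A `σ`-Dedekind complete Riesz space is Archimedean. -/
theorem SigmaDedekindComplete.nonpos_of_forall_nsmul_le (hE : SigmaDedekindComplete E) {a b : E}
    (h : ∀ n : ℕ, n • b ≤ a) : b ≤ 0 := by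
  obtain ⟨s, hs⟩ := hE (range fun n : ℕ => n • b) (range_nonempty _) (countable_range _)
    ⟨a, by rintro _ ⟨n, rfl⟩; exact h n⟩
  -- The multiples of `b` are stable under adding `b`, so `s - b` is again an upper bound of them.
  have h1 : s ≤ s - b := hs.2 (by
    rintro _ ⟨n, rfl⟩
    have := hs.1 ⟨n + 1, rfl⟩
    simp only [succ_nsmul] at this
    exact le_sub_iff_add_le.2 this)
  simpa using h1

variable [Module ℝ E] [IsOrderedModule ℝ E]

theorem SigmaDedekindComplete.nonpos_of_forall_le_smul (hE : SigmaDedekindComplete E) {a b : E}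
    {r : ℕ → ℝ} (hr : IsGLB (range r) 0) (ha : 0 ≤ a) (h : ∀ n, b ≤ r n • a) : b ≤ 0 := by
  refine hE.nonpos_of_forall_nsmul_le (a := a) fun k => ?_
  rcases k.eq_zero_or_pos with rfl | hk
  · simpa using ha
  have hk' : (0 : ℝ) < k := by exact_mod_cast hk
  obtain ⟨_, ⟨n, rfl⟩, -, hn⟩ := hr.exists_between (inv_pos.2 hk')
  have h1 : (k : ℝ) • b ≤ (k : ℝ) • r n • a := smul_le_smul_of_nonneg_left (h n) hk'.le
  rw [Nat.cast_smul_eq_nsmul, smul_smul] at h1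
  refine h1.trans ?_
  calc ((k : ℝ) * r n) • a ≤ (1 : ℝ) • a := by
        refine smul_le_smul_of_nonneg_right ?_ ha
        calc (k : ℝ) * r n ≤ k * (k : ℝ)⁻¹ := by gcongr
          _ = 1 := mul_inv_cancel₀ hk'.ne'
    _ = a := one_smul _ _

theorem SigmaDedekindComplete.isGLB_smul (hE : SigmaDedekindComplete E) {a : E} (ha : 0 ≤ a)
    {r : ℕ → ℝ} (hr : IsGLB (range r) 0) : IsGLB (range fun n => r n • a) 0 := by
  refine ⟨?_, fun b hb => hE.nonpos_of_forall_le_smul hr ha fun n => hb ⟨n, rfl⟩⟩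
  rintro _ ⟨n, rfl⟩
  exact smul_nonneg (hr.1 ⟨n, rfl⟩) ha

end Archimedean

/-- Separate continuity gives the iterated supremum of `x n * y m`; by monotonicity each such
product lies below the diagonal one with index `max n m`. -/
theorem isLUB_range_mul {E : Type*} [NonUnitalRing E] [PartialOrder E]
    (h : SigmaMonotoneContinuousMul E) {x y : ℕ → E} {a b : E} (hx : Monotone x) (hy : Monotone y)
    (hx0 : ∀ n, 0 ≤ x n) (hy0 : ∀ n, 0 ≤ y n) (ha : IsLUB (range x) a) (hb : IsLUB (range y) b) :
    IsLUB (range fun n => x n * y n) (a * b) := by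
  have ha0 : 0 ≤ a := (hx0 0).trans (ha.1 ⟨0, rfl⟩)
  have hb0 : 0 ≤ b := (hy0 0).trans (hb.1 ⟨0, rfl⟩)
  obtain ⟨-, -, -, hab⟩ := h x a hx0 ha0 hx ha b hb0
  have hxb : ∀ n, IsLUB (range fun m => x n * y m) (x n * b) := fun n =>
    (h y b hy0 hb0 hy hb (x n) (hx0 n)).2.1
  constructor
  · rintro _ ⟨n, rfl⟩
    exact ((hxb n).1 ⟨n, rfl⟩).trans (hab.1 ⟨n, rfl⟩)
  · intro c hc
    refine hab.2 ?_
    rintro _ ⟨n, rfl⟩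
    refine (hxb n).2 ?_
    rintro _ ⟨m, rfl⟩
    refine le_trans ?_ (hc ⟨max n m, rfl⟩)
    exact ((h y b hy0 hb0 hy hb (x n) (hx0 n)).1 (le_max_right n m)).trans
      ((h x a hx0 ha0 hx ha _ (hy0 (max n m))).2.2.1 (le_max_left n m))

/-! ### Finite measures with values in a partially ordered vector space -/

namespace FiniteOrderMeasure

open MeasureTheory

section Measure

variable {X : Type*} [MeasurableSpace X] {E : Type*} [AddCommGroup E] [PartialOrder E]
  [IsOrderedAddMonoid E] (μ : FiniteOrderMeasure X E)

theorem mono {s t : Set X} (hs : MeasurableSet s) (ht : MeasurableSet t) (hst : s ⊆ t) :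
    μ s ≤ μ t := by
  have h := μ.union_eq_add hs (ht.diff hs) disjoint_sdiff_right
  rw [union_sdiff_cancel hst] at h
  rw [h]
  exact le_add_of_nonneg_right (μ.nonneg' _ (ht.diff hs))

theorem null_of_subset {s t : Set X} (hs : MeasurableSet s) (ht : MeasurableSet t) (hst : s ⊆ t)
    (h : μ t = 0) : μ s = 0 :=
  le_antisymm (h ▸ μ.mono hs ht hst) (μ.nonneg' s hs)

theorem biUnion_finset {ι : Type*} (s : Finset ι) {f : ι → Set X}
    (hf : ∀ i, MeasurableSet (f i)) (hd : Pairwise fun i j => Disjoint (f i) (f j)) :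
    μ (⋃ i ∈ s, f i) = ∑ i ∈ s, μ (f i) := by
  classical
  induction s using Finset.induction_on with
  | empty => simp [μ.empty']
  | insert a s ha ih =>
    rw [Finset.set_biUnion_insert, Finset.sum_insert ha, ← ih]
    refine μ.union_eq_add (hf a) (s.measurableSet_biUnion fun i _ => hf i) ?_
    rw [disjoint_iUnion₂_right]
    exact fun i hi => hd (ne_of_mem_of_not_mem hi ha).symm

theorem isLUB_iUnion {s : ℕ → Set X} (hs : ∀ n, MeasurableSet (s n)) (hm : Monotone s) :
    IsLUB (range fun n => μ (s n)) (μ (⋃ n, s n)) := by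
  have hd : ∀ n, MeasurableSet (disjointed s n) := MeasurableSet.disjointed hs
  constructor
  · rintro _ ⟨n, rfl⟩
    exact μ.mono (hs n) (MeasurableSet.iUnion hs) (subset_iUnion s n)
  · intro c hc
    have h := μ.iUnion' _ hd (disjoint_disjointed s)
    rw [iUnion_disjointed] at h
    refine h.2 ?_
    rintro _ ⟨N, rfl⟩
    change ∑ n ∈ Finset.range N, μ (disjointed s n) ≤ c
    rw [← μ.biUnion_finset _ hd (disjoint_disjointed s)]
    refine (μ.mono (Finset.measurableSet_biUnion _ fun i _ => hd i) (hs N) ?_).trans (hc ⟨N, rfl⟩)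
    refine iUnion₂_subset fun i hi => (disjointed_subset s i).trans (hm (Finset.mem_range.1 hi).le)

theorem null_iUnion {s : ℕ → Set X} (hs : ∀ n, MeasurableSet (s n)) (h0 : ∀ n, μ (s n) = 0) :
    μ (⋃ n, s n) = 0 := by
  have hd : ∀ n, MeasurableSet (disjointed s n) := MeasurableSet.disjointed hs
  have h := μ.iUnion' _ hd (disjoint_disjointed s)
  rw [iUnion_disjointed] at h
  refine le_antisymm (h.2 ?_) (μ.nonneg' _ (MeasurableSet.iUnion hs))
  rintro _ ⟨N, rfl⟩
  exact (Finset.sum_eq_zero fun n _ =>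
    μ.null_of_subset (hd n) (hs n) (disjointed_subset s n) (h0 n)).le

theorem mem_ae {s : Set X} : s ∈ μ.ae ↔ ∃ t, MeasurableSet t ∧ μ t = 0 ∧ sᶜ ⊆ t := Iff.rfl

theorem compl_mem_ae {s : Set X} (hs : MeasurableSet s) : sᶜ ∈ μ.ae ↔ μ s = 0 := by
  rw [mem_ae, compl_compl]
  exact ⟨fun ⟨t, ht, h0, h⟩ => μ.null_of_subset hs ht h h0, fun h => ⟨s, hs, h, Subset.rfl⟩⟩

/-- This closure under countable intersections is what lets the germs along `μ.ae` inherit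
sequential order properties from the real line. -/
theorem ae_all {p : ℕ → X → Prop} (h : ∀ n, ∀ᶠ x in μ.ae, p n x) : ∀ᶠ x in μ.ae, ∀ n, p n x := by
  choose t ht h0 hsub using h
  refine ⟨⋃ n, t n, MeasurableSet.iUnion ht, μ.null_iUnion ht h0, ?_⟩
  intro x hx
  simp only [mem_compl_iff, mem_ofPred_eq, not_forall] at hx
  obtain ⟨n, hn⟩ := hx
  exact mem_iUnion.2 ⟨n, hsub n hn⟩

end Measure

/-! ### The integral of elementary functions -/

section Elementary

variable {X : Type*} [MeasurableSpace X] {E : Type*} [AddCommGroup E] [PartialOrder E]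
  [IsOrderedAddMonoid E] [Module ℝ E] (μ : FiniteOrderMeasure X E)

/-- The level sets of `g ∘ φ` are finite disjoint unions of fibres of `φ`. Applied to a pair of
elementary functions this provides the common refinement; `s` may exceed the range because empty
fibres contribute nothing. -/
theorem elementaryIntegral_map {β : Type*} (φ : SimpleFunc X β) (g : β → ℝ≥0) (s : Finset β)
    (hs : φ.range ⊆ s) :
    μ.elementaryIntegral (φ.map g) = ∑ b ∈ s, (g b : ℝ) • μ (φ ⁻¹' {b}) := by
  classical
  have hd : Pairwise fun b c => Disjoint (φ ⁻¹' {b}) (φ ⁻¹' {c}) := fun b c hbc =>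
    Disjoint.preimage _ (by simpa using hbc)
  have h0 : ∀ b ∉ φ.range, μ (φ ⁻¹' {b}) = 0 := by
    intro b hb
    rw [preimage_singleton_eq_empty.2 (by simpa using hb), μ.empty']
  rw [← Finset.sum_subset hs fun b _ hb => by rw [h0 b hb, smul_zero], elementaryIntegral,
    SimpleFunc.range_map,
    ← Finset.sum_fiberwise_of_maps_to (fun b hb => Finset.mem_image_of_mem g hb)]
  refine Finset.sum_congr rfl fun r _ => ?_
  have : φ.map g ⁻¹' {r} = ⋃ b ∈ φ.range.filter (g · = r), φ ⁻¹' {b} := by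
    ext x; simp
  rw [this, μ.biUnion_finset _ φ.measurableSet_fiber hd, Finset.smul_sum]
  refine Finset.sum_congr rfl fun b hb => ?_
  rw [(Finset.mem_filter.1 hb).2]

theorem elementaryIntegral_eq_sum (φ : SimpleFunc X ℝ≥0) (s : Finset ℝ≥0) (hs : φ.range ⊆ s) :
    μ.elementaryIntegral φ = ∑ b ∈ s, (b : ℝ) • μ (φ ⁻¹' {b}) :=
  μ.elementaryIntegral_map φ id s hs

theorem elementaryIntegral_add (φ ψ : SimpleFunc X ℝ≥0) :
    μ.elementaryIntegral (φ + ψ) = μ.elementaryIntegral φ + μ.elementaryIntegral ψ := by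
  have h1 := μ.elementaryIntegral_map (φ.pair ψ) (fun p => p.1 + p.2) _ Subset.rfl
  have h2 := μ.elementaryIntegral_map (φ.pair ψ) (fun p => p.1) _ Subset.rfl
  have h3 := μ.elementaryIntegral_map (φ.pair ψ) (fun p => p.2) _ Subset.rfl
  change μ.elementaryIntegral (φ + ψ) = _ at h1
  change μ.elementaryIntegral φ = _ at h2
  change μ.elementaryIntegral ψ = _ at h3
  rw [h1, h2, h3, ← Finset.sum_add_distrib]
  simp [add_smul]

theorem elementaryIntegral_smul (c : ℝ≥0) (φ : SimpleFunc X ℝ≥0) :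
    μ.elementaryIntegral (φ.map (c * ·)) = (c : ℝ) • μ.elementaryIntegral φ := by
  rw [μ.elementaryIntegral_map φ _ _ Subset.rfl, elementaryIntegral, Finset.smul_sum]
  simp [mul_smul]

theorem elementaryIntegral_const (c : ℝ≥0) :
    μ.elementaryIntegral (SimpleFunc.const X c) = (c : ℝ) • μ univ := by
  rw [μ.elementaryIntegral_eq_sum _ {c} (by intro x; simp +contextual)]
  have : (SimpleFunc.const X c : X → ℝ≥0) ⁻¹' {c} = univ := by ext; simp
  rw [Finset.sum_singleton, this]

theorem elementaryIntegral_indicator {s : Set X} (hs : MeasurableSet s) :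
    μ.elementaryIntegral (.piecewise s hs (.const X 1) (.const X 0)) = μ s := by
  classical
  rw [μ.elementaryIntegral_eq_sum _ {0, 1} (by
    intro x hx
    obtain ⟨y, rfl⟩ := SimpleFunc.mem_range.1 hx
    by_cases h : y ∈ s <;> simp [h])]
  rw [Finset.sum_pair zero_ne_one]
  have : (SimpleFunc.piecewise s hs (.const X 1) (.const X 0) : X → ℝ≥0) ⁻¹' {1} = s := by
    ext x; by_cases h : x ∈ s <;> simp [h]
  rw [this]
  simp

variable [IsOrderedModule ℝ E]

theorem elementaryIntegral_nonneg (φ : SimpleFunc X ℝ≥0) : 0 ≤ μ.elementaryIntegral φ :=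
  Finset.sum_nonneg fun r _ => smul_nonneg r.2 (μ.nonneg' _ (φ.measurableSet_fiber r))

theorem elementaryIntegral_mono {φ ψ : SimpleFunc X ℝ≥0} (h : φ ≤ ψ) :
    μ.elementaryIntegral φ ≤ μ.elementaryIntegral ψ := by
  -- Truncated subtraction in `ℝ≥0` keeps the difference elementary.
  have h1 : ψ = φ + (ψ - φ) := by
    ext x
    simp [add_tsub_cancel_of_le (h x)]
  rw [h1, elementaryIntegral_add]
  exact le_add_of_nonneg_right (μ.elementaryIntegral_nonneg _)

end Elementary

section Spectral

variable {X : Type*} [MeasurableSpace X] {A : Type*} [Ring A] [Lattice A] [IsOrderedRing A]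
  [Algebra ℝ A] {μ : FiniteOrderMeasure X A}

theorem IsSpectral.elementaryIntegral_mul (hμ : μ.IsSpectral) (φ ψ : SimpleFunc X ℝ≥0) :
    μ.elementaryIntegral (φ * ψ) = μ.elementaryIntegral φ * μ.elementaryIntegral ψ := by
  -- The sum runs over the full product of the ranges, not the range of the pair, so that it
  -- factors.
  have h1 := μ.elementaryIntegral_map (φ.pair ψ) (fun p => p.1 * p.2) (φ.range ×ˢ ψ.range) (by
    intro p
    simp only [SimpleFunc.mem_range, Finset.mem_product]
    rintro ⟨x, rfl⟩
    exact ⟨⟨x, rfl⟩, ⟨x, rfl⟩⟩)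
  change μ.elementaryIntegral (φ * ψ) = _ at h1
  rw [h1, Finset.sum_product, elementaryIntegral, elementaryIntegral, Finset.sum_mul_sum]
  refine Finset.sum_congr rfl fun r _ => Finset.sum_congr rfl fun t _ => ?_
  rw [SimpleFunc.pair_preimage_singleton,
    hμ _ _ (φ.measurableSet_fiber r) (ψ.measurableSet_fiber t), smul_mul_smul_comm]
  simp

end Spectral

end FiniteOrderMeasure

/-! ### The order integral of non-negative functions -/

namespace FiniteOrderMeasure

open MeasureTheory

namespace HasPosIntegral

section

variable {X : Type*} [MeasurableSpace X] {E : Type*} [AddCommGroup E] [PartialOrder E]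
  [Module ℝ E] {μ : FiniteOrderMeasure X E} {f g : X → ℝ} {a b : E}

theorem nonneg_fun (h : μ.HasPosIntegral f a) : 0 ≤ f := by
  obtain ⟨φ, -, ht, -⟩ := h
  exact fun x => ge_of_tendsto' (ht x) fun n => (φ n x).2

theorem measurable (h : μ.HasPosIntegral f a) : Measurable f := by
  obtain ⟨φ, -, ht, -⟩ := h
  exact measurable_of_tendsto_metrizable (fun n => measurable_coe_nnreal_real.comp (φ n).measurable)
    (tendsto_pi_nhds.2 ht)

theorem const_fun (φ : SimpleFunc X ℝ≥0) :
    μ.HasPosIntegral (fun x => (φ x : ℝ)) (μ.elementaryIntegral φ) :=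
  ⟨fun _ => φ, fun _ => monotone_const, fun _ => tendsto_const_nhds, by simp⟩

variable [IsOrderedAddMonoid E]

theorem indicator {s : Set X} (hs : MeasurableSet s) :
    μ.HasPosIntegral (s.indicator 1) (μ s) := by
  have h := const_fun (μ := μ) (.piecewise s hs (.const X 1) (.const X 0))
  rw [μ.elementaryIntegral_indicator hs] at h
  convert h using 1
  ext x
  by_cases hx : x ∈ s <;> simp [hx]

theorem const (c : ℝ≥0) : μ.HasPosIntegral (fun _ => (c : ℝ)) ((c : ℝ) • μ univ) := by
  have h := const_fun (μ := μ) (.const X c)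
  rw [μ.elementaryIntegral_const] at h
  simpa using h

variable [IsOrderedModule ℝ E]

theorem add (hf : μ.HasPosIntegral f a) (hg : μ.HasPosIntegral g b) :
    μ.HasPosIntegral (f + g) (a + b) := by
  obtain ⟨φ, hφm, hφt, hφ⟩ := hf
  obtain ⟨ψ, hψm, hψt, hψ⟩ := hg
  refine ⟨fun n => φ n + ψ n, fun x => (hφm x).add (hψm x),
    fun x => by simpa using (hφt x).add (hψt x), ?_⟩
  simp only [μ.elementaryIntegral_add]
  exact isLUB_range_add (fun m n hmn => μ.elementaryIntegral_mono fun x => hφm x hmn)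
    (fun m n hmn => μ.elementaryIntegral_mono fun x => hψm x hmn) hφ hψ

theorem smul (hf : μ.HasPosIntegral f a) {r : ℝ} (hr : 0 ≤ r) :
    μ.HasPosIntegral (r • f) (r • a) := by
  obtain ⟨φ, hφm, hφt, hφ⟩ := hf
  lift r to ℝ≥0 using hr
  refine ⟨fun n => (φ n).map (r * ·), fun x m n hmn => ?_, fun x => ?_, ?_⟩
  · simpa using mul_le_mul_right (hφm x hmn) r
  · simpa using (hφt x).const_mul (r : ℝ)
  · simp only [μ.elementaryIntegral_smul]
    exact isLUB_range_smul r.2 hφ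

theorem nonneg (hf : μ.HasPosIntegral f a) : 0 ≤ a := by
  obtain ⟨φ, -, -, hφ⟩ := hf
  exact (μ.elementaryIntegral_nonneg (φ 0)).trans (hφ.1 ⟨0, rfl⟩)

end

end HasPosIntegral

/-! ### Comparison, uniqueness and convergence for the positive integral -/

section

variable {X : Type*} [MeasurableSpace X]

/-- A non-negative measurable function is the limit of an increasing sequence of elementary
functions. -/
theorem exists_elementary_tendsto {f : X → ℝ} (hf : Measurable f) (h0 : 0 ≤ f) :
    ∃ φ : ℕ → SimpleFunc X ℝ≥0, (∀ x, Monotone fun n => φ n x) ∧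
      (∀ x, Tendsto (fun n => (φ n x : ℝ)) atTop (𝓝 (f x))) ∧ ∀ n x, (φ n x : ℝ) ≤ f x := by
  let F : X → ENNReal := fun x => ENNReal.ofReal (f x)
  have hF : Measurable F := hf.ennreal_ofReal
  let φ : ℕ → SimpleFunc X ℝ≥0 := fun n => (SimpleFunc.eapprox F n).map ENNReal.toNNReal
  have hm : ∀ x, Monotone fun n => φ n x := fun x m n hmn =>
    ENNReal.toNNReal_mono (SimpleFunc.eapprox_lt_top F n x).ne (SimpleFunc.monotone_eapprox F hmn x)
  have ht : ∀ x, Tendsto (fun n => (φ n x : ℝ)) atTop (𝓝 (f x)) := by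
    intro x
    have h1 := (ENNReal.tendsto_toNNReal (ENNReal.ofReal_ne_top (r := f x))).comp
      (SimpleFunc.tendsto_eapprox hF x)
    have h2 := NNReal.tendsto_coe.2 h1
    change Tendsto _ _ (𝓝 ((f x).toNNReal : ℝ)) at h2
    rwa [Real.coe_toNNReal _ (h0 x)] at h2
  exact ⟨φ, hm, ht, fun n x => Monotone.ge_of_tendsto (f := fun n => (φ n x : ℝ))
    (fun m n hmn => hm x hmn) (ht x) n⟩

variable {A : Type*} [Ring A] [Lattice A] [IsOrderedRing A] [Algebra ℝ A]
  {μ : FiniteOrderMeasure X A}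

theorem IsSpectral.elementaryIntegral_mul_univ (hμ : μ.IsSpectral) (φ : SimpleFunc X ℝ≥0) :
    μ.elementaryIntegral φ * μ univ = μ.elementaryIntegral φ := by
  have h := μ.elementaryIntegral_const 1
  rw [NNReal.coe_one, one_smul] at h
  rw [← h, ← hμ.elementaryIntegral_mul]
  congr 1
  ext x
  simp

variable [IsOrderedModule ℝ A]

/-- The pointwise hypothesis says `φ ≤ sup ψ n` without requiring this supremum to be finite.
Spectrality turns restriction to a set into multiplication by its measure, so continuity of `μ` from
below combines with continuity of the multiplication. -/
theorem IsSpectral.elementaryIntegral_le (hμ : μ.IsSpectral) (hA : SigmaDedekindComplete A)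
    (hmul : SigmaMonotoneContinuousMul A) {φ : SimpleFunc X ℝ≥0} {ψ : ℕ → SimpleFunc X ℝ≥0} {a : A}
    (hψ : ∀ x, Monotone fun n => ψ n x) (h : ∀ x, ∀ c < φ x, ∃ n, c < ψ n x)
    (ha : ∀ n, μ.elementaryIntegral (ψ n) ≤ a) : μ.elementaryIntegral φ ≤ a := by
  set I := μ.elementaryIntegral φ with hI
  have hI0 : 0 ≤ I := μ.elementaryIntegral_nonneg φ
  have key : ∀ c : ℝ≥0, c < 1 → (c : ℝ) • I ≤ a := by
    intro c hc
    let s : ℕ → Set X := fun n => (φ.pair (ψ n)) ⁻¹' {p | c * p.1 ≤ p.2}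
    have hs : ∀ n, MeasurableSet (s n) := fun n => SimpleFunc.measurableSet_preimage _ _
    have hsm : Monotone s := fun m n hmn x (hx : c * φ x ≤ ψ m x) => hx.trans (hψ x hmn)
    have hU : ⋃ n, s n = univ := by
      refine eq_univ_of_forall fun x => mem_iUnion.2 ?_
      rcases eq_zero_or_pos (φ x) with h0 | h0
      -- Where `φ` vanishes the hypothesis `h` is void, but the inequality is trivial for any index.
      · exact ⟨0, show c * φ x ≤ ψ 0 x by simp [h0]⟩
      · obtain ⟨n, hn⟩ := h x (c * φ x) (mul_lt_of_lt_one_left h0 hc)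
        exact ⟨n, hn.le⟩
    have hlub := μ.isLUB_iUnion hs hsm
    rw [hU] at hlub
    have hlub' := (hmul _ _ (fun n => μ.nonneg' _ (hs n)) (μ.nonneg' _ .univ)
      (fun m n hmn => μ.mono (hs m) (hs n) (hsm hmn)) hlub ((c : ℝ) • I) (smul_nonneg c.2 hI0)).2.1
    rw [smul_mul_assoc, hI, hμ.elementaryIntegral_mul_univ] at hlub'
    refine hlub'.2 ?_
    rintro _ ⟨n, rfl⟩
    refine le_trans ?_ (ha n)
    change ((c : ℝ) • μ.elementaryIntegral φ) * μ (s n) ≤ _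
    rw [← μ.elementaryIntegral_smul, ← μ.elementaryIntegral_indicator (hs n),
      ← hμ.elementaryIntegral_mul]
    refine μ.elementaryIntegral_mono fun x => ?_
    by_cases hx : x ∈ s n
    · simpa [hx] using (show c * φ x ≤ ψ n x from hx)
    · simp [hx]
  -- Taking `c = 1 - 1 / (n + 1)` in `key` gives `I - a ≤ (1 / (n + 1)) • I`, and `A` is
  -- Archimedean.
  have h2 : I - a ≤ 0 := by
    refine hA.nonpos_of_forall_le_smul (a := I) (r := fun n : ℕ => 1 / ((n : ℝ) + 1)) ?_ hI0
      fun n => ?_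
    · exact isGLB_of_tendsto_atTop (fun m n hmn => one_div_le_one_div_of_le (by positivity)
        (by exact_mod_cast Nat.succ_le_succ hmn)) tendsto_one_div_add_atTop_nhds_zero_nat
    · have hr : 1 / ((n : ℝ) + 1) ≤ 1 := by
        rw [div_le_one (by positivity)]; linarith [n.cast_nonneg (α := ℝ)]
      have := key (1 - 1 / ((n : ℝ) + 1)).toNNReal (by
        rw [← NNReal.coe_lt_coe, Real.coe_toNNReal _ (sub_nonneg.2 hr), NNReal.coe_one]
        exact sub_lt_self _ (by positivity))
      rw [Real.coe_toNNReal _ (sub_nonneg.2 hr)] at this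
      rw [sub_smul, one_smul] at this
      exact sub_le_comm.1 this
  exact sub_nonpos.1 h2

/-- The order integral of a non-negative function is the supremum of the integrals of all
elementary functions below it. -/
theorem HasPosIntegral.isLUB (hμ : μ.IsSpectral) (hA : SigmaDedekindComplete A)
    (hmul : SigmaMonotoneContinuousMul A) {f : X → ℝ} {a : A} (h : μ.HasPosIntegral f a) :
    IsLUB (μ.elementaryIntegral '' {φ | ∀ x, (φ x : ℝ) ≤ f x}) a := by
  obtain ⟨φ, hm, ht, hlub⟩ := h
  constructor
  · rintro _ ⟨ψ, hψ, rfl⟩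
    refine hμ.elementaryIntegral_le hA hmul hm (fun x c hc => ?_) fun n => hlub.1 ⟨n, rfl⟩
    have h1 : (c : ℝ) < f x := (NNReal.coe_lt_coe.2 hc).trans_le (hψ x)
    obtain ⟨n, hn⟩ := ((ht x).eventually (lt_mem_nhds h1)).exists
    exact ⟨n, NNReal.coe_lt_coe.1 hn⟩
  · intro b hb
    refine hlub.2 ?_
    rintro _ ⟨n, rfl⟩
    exact hb ⟨φ n, fun x => Monotone.ge_of_tendsto (f := fun n => (φ n x : ℝ))
      (fun m n hmn => hm x hmn) (ht x) n, rfl⟩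

theorem HasPosIntegral.mono (hμ : μ.IsSpectral) (hA : SigmaDedekindComplete A)
    (hmul : SigmaMonotoneContinuousMul A) {f g : X → ℝ} {a b : A} (hf : μ.HasPosIntegral f a)
    (hg : μ.HasPosIntegral g b) (h : f ≤ g) : a ≤ b := by
  refine (hf.isLUB hμ hA hmul).2 ?_
  rintro _ ⟨φ, hφ, rfl⟩
  exact (hg.isLUB hμ hA hmul).1 ⟨φ, fun x => (hφ x).trans (h x), rfl⟩

theorem HasPosIntegral.unique (hμ : μ.IsSpectral) (hA : SigmaDedekindComplete A)
    (hmul : SigmaMonotoneContinuousMul A) {f : X → ℝ} {a b : A} (ha : μ.HasPosIntegral f a)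
    (hb : μ.HasPosIntegral f b) : a = b :=
  le_antisymm (ha.mono hμ hA hmul hb le_rfl) (hb.mono hμ hA hmul ha le_rfl)

/-- The integrals of elementary functions approximating `f` from below are bounded by `b`, so
σ-Dedekind completeness supplies their supremum. -/
theorem HasPosIntegral.exists_of_le (hμ : μ.IsSpectral) (hA : SigmaDedekindComplete A)
    (hmul : SigmaMonotoneContinuousMul A) {f g : X → ℝ} {b : A} (hg : μ.HasPosIntegral g b)
    (hf : Measurable f) (h0 : 0 ≤ f) (h : f ≤ g) : ∃ a, μ.HasPosIntegral f a := by
  obtain ⟨φ, hm, ht, hle⟩ := exists_elementary_tendsto hf h0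
  obtain ⟨a, ha⟩ := hA (range fun n => μ.elementaryIntegral (φ n)) (range_nonempty _)
    (countable_range _) ⟨b, by
      rintro _ ⟨n, rfl⟩
      exact (hg.isLUB hμ hA hmul).1 ⟨φ n, fun x => (hle n x).trans (h x), rfl⟩⟩
  exact ⟨a, φ, hm, ht, ha⟩

theorem HasPosIntegral.mul (hμ : μ.IsSpectral) (hmul : SigmaMonotoneContinuousMul A)
    {f g : X → ℝ} {a b : A} (hf : μ.HasPosIntegral f a) (hg : μ.HasPosIntegral g b) :
    μ.HasPosIntegral (f * g) (a * b) := by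
  obtain ⟨φ, hφm, hφt, hφ⟩ := hf
  obtain ⟨ψ, hψm, hψt, hψ⟩ := hg
  refine ⟨fun n => φ n * ψ n, fun x m n hmn => mul_le_mul' (hφm x hmn) (hψm x hmn),
    fun x => by simpa using (hφt x).mul (hψt x), ?_⟩
  simp only [hμ.elementaryIntegral_mul]
  exact isLUB_range_mul hmul (fun m n hmn => μ.elementaryIntegral_mono fun x => hφm x hmn)
    (fun m n hmn => μ.elementaryIntegral_mono fun x => hψm x hmn)
    (fun n => μ.elementaryIntegral_nonneg _) (fun n => μ.elementaryIntegral_nonneg _) hφ hψ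

/-- Monotone convergence. -/
theorem HasPosIntegral.isLUB_of_tendsto (hμ : μ.IsSpectral) (hA : SigmaDedekindComplete A)
    (hmul : SigmaMonotoneContinuousMul A) {f : ℕ → X → ℝ} {g : X → ℝ} {a : ℕ → A} {b : A}
    (hf : ∀ n, μ.HasPosIntegral (f n) (a n)) (hg : μ.HasPosIntegral g b) (hm : Monotone f)
    (ht : ∀ x, Tendsto (fun n => f n x) atTop (𝓝 (g x))) : IsLUB (range a) b := by
  have hfg : ∀ n, f n ≤ g := fun n x =>
    Monotone.ge_of_tendsto (f := fun n => f n x) (fun m n hmn => hm hmn x) (ht x) n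
  refine ⟨?_, fun c hc => (hg.isLUB hμ hA hmul).2 ?_⟩
  · rintro _ ⟨n, rfl⟩
    exact (hf n).mono hμ hA hmul hg (hfg n)
  rintro _ ⟨φ, hφ, rfl⟩
  choose ψ hψm hψt hψ using hf
  have hψf : ∀ n k x, (ψ n k x : ℝ) ≤ f n x := fun n k x =>
    Monotone.ge_of_tendsto (f := fun k => (ψ n k x : ℝ)) (fun _ _ h => hψm n x h) (hψt n x) k
  -- The diagonal maxima of the first `k + 1` approximants at stage `k` increase with `k`, stay
  -- below `f k`, and eventually exceed any number below `g x`.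
  let Ψ : ℕ → SimpleFunc X ℝ≥0 := fun k => (Finset.range (k + 1)).sup fun n => ψ n k
  have hΨ : ∀ k x, Ψ k x = (Finset.range (k + 1)).sup fun n => ψ n k x := fun k x =>
    SimpleFunc.finset_sup_apply _ _
  refine hμ.elementaryIntegral_le hA hmul (ψ := Ψ) (fun x k l hkl => ?_) (fun x c hc => ?_)
    fun k => ?_
  · simp only [hΨ]
    exact Finset.sup_le fun n hn => (hψm n x hkl).trans
      (Finset.le_sup (f := fun n => ψ n l x) (Finset.range_mono (Nat.succ_le_succ hkl) hn))
  · have h1 : (c : ℝ) < g x := (NNReal.coe_lt_coe.2 hc).trans_le (hφ x)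
    obtain ⟨n, hn⟩ := ((ht x).eventually (lt_mem_nhds h1)).exists
    obtain ⟨k, hk, hnk⟩ := (((hψt n x).eventually (lt_mem_nhds hn)).and
      (eventually_ge_atTop n)).exists
    refine ⟨k, (NNReal.coe_lt_coe.1 hk).trans_le ?_⟩
    rw [hΨ]
    exact Finset.le_sup (f := fun n => ψ n k x) (Finset.mem_range.2 (Nat.lt_succ_of_le hnk))
  · refine le_trans ?_ (hc ⟨k, rfl⟩)
    refine (HasPosIntegral.isLUB hμ hA hmul ⟨ψ k, hψm k, hψt k, hψ k⟩).1 ⟨Ψ k, fun x => ?_, rfl⟩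
    rw [hΨ]
    refine Finset.sup_induction (p := fun r : ℝ≥0 => (r : ℝ) ≤ f k x) ?_ ?_ ?_
    · exact (NNReal.coe_nonneg _).trans (hψf k 0 x)
    · intro r hr t ht
      rw [NNReal.coe_max]
      exact max_le hr ht
    · exact fun n hn => (hψf n k x).trans (hm (Nat.le_of_lt_succ (Finset.mem_range.1 hn)) x)

/-- The constant function `1` has integral `μ univ`, and the integral is multiplicative. -/
theorem HasPosIntegral.mul_univ (hμ : μ.IsSpectral) (hA : SigmaDedekindComplete A)
    (hmul : SigmaMonotoneContinuousMul A) {f : X → ℝ} {a : A} (h : μ.HasPosIntegral f a) :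
    a * μ univ = a ∧ μ univ * a = a := by
  have h1 : μ.HasPosIntegral (1 : X → ℝ) (μ univ) := by
    simpa using HasPosIntegral.indicator (μ := μ) .univ
  constructor
  · have := h.mul hμ hmul h1
    rw [mul_one] at this
    exact this.unique hμ hA hmul h
  · have := h1.mul hμ hmul h
    rw [one_mul] at this
    exact this.unique hμ hA hmul h

/-- With `s` the support of `f`, multiplicativity gives `a = a * μ s` and `b = b * μ sᶜ`. Since `μ s
* μ sᶜ = 0`, right multiplication by `μ sᶜ` kills `a`, by `μ s` kills `b`, and by `1 - μ univ` kills
`a`. All three factors are positive, which for the last one is the assumption `μ univ ≤ 1`, so each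
of them kills `a ⊓ b`. -/
theorem HasPosIntegral.inf_eq_zero (hμ : μ.IsSpectral) (hμe : μ univ ≤ 1)
    (hA : SigmaDedekindComplete A)
    (hmul : SigmaMonotoneContinuousMul A) {f g : X → ℝ} {a b : A} (hf : μ.HasPosIntegral f a)
    (hg : μ.HasPosIntegral g b) (h : ∀ x, f x = 0 ∨ g x = 0) : a ⊓ b = 0 := by
  let s : Set X := {x | f x ≠ 0}
  have hs : MeasurableSet s := (hf.measurable (measurableSet_singleton 0)).compl
  have h1 : a * μ s = a := by
    refine HasPosIntegral.unique hμ hA hmul ?_ hf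
    convert hf.mul hμ hmul (.indicator hs) using 1
    ext x
    by_cases hx : f x = 0 <;> simp [s, hx]
  have h2 : b * μ sᶜ = b := by
    refine HasPosIntegral.unique hμ hA hmul ?_ hg
    convert hg.mul hμ hmul (.indicator hs.compl) using 1
    ext x
    rcases h x with hx | hx <;> simp [s, hx]
  have h3 : μ s * μ sᶜ = 0 := by
    rw [← hμ s sᶜ hs hs.compl, inter_compl_self, μ.empty']
  have h4 : μ sᶜ * μ s = 0 := by
    rw [← hμ _ _ hs.compl hs, inter_comm, inter_compl_self, μ.empty']
  have h5 : μ s + μ sᶜ = μ univ := by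
    rw [← μ.union_eq_add hs hs.compl disjoint_compl_right, union_compl_self]
  have hd0 : 0 ≤ a ⊓ b := le_inf hf.nonneg hg.nonneg
  have hda : (a ⊓ b) * μ sᶜ ≤ 0 := by
    calc (a ⊓ b) * μ sᶜ ≤ a * μ sᶜ := mul_le_mul_of_nonneg_right inf_le_left (μ.nonneg' _ hs.compl)
      _ = 0 := by rw [← h1, mul_assoc, h3, mul_zero]
  have hdc : (a ⊓ b) * (1 - μ univ) ≤ 0 := by
    calc (a ⊓ b) * (1 - μ univ) ≤ a * (1 - μ univ) :=
          mul_le_mul_of_nonneg_right inf_le_left (sub_nonneg.2 hμe)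
      _ = 0 := by rw [mul_sub, mul_one, (hf.mul_univ hμ hA hmul).1, sub_self]
  have hdb : (a ⊓ b) * μ s ≤ 0 := by
    calc (a ⊓ b) * μ s ≤ b * μ s := mul_le_mul_of_nonneg_right inf_le_right (μ.nonneg' _ hs)
      _ = 0 := by rw [← h2, mul_assoc, h4, mul_zero]
  refine le_antisymm ?_ hd0
  calc a ⊓ b = (a ⊓ b) * μ sᶜ + (a ⊓ b) * μ s + (a ⊓ b) * (1 - μ univ) := by
        rw [← h5]; noncomm_ring
    _ ≤ 0 + 0 + 0 := by gcongr
    _ = 0 := by simp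

/-- Chebyshev's inequality: `1 / (n + 1)` times the measure of `{f ≥ 1 / (n + 1)}` is at most `∫ f =
0`, and countably many null sets may be united. -/
theorem HasPosIntegral.eventually_eq_zero (hμ : μ.IsSpectral) (hA : SigmaDedekindComplete A)
    (hmul : SigmaMonotoneContinuousMul A) {f : X → ℝ} (hf : μ.HasPosIntegral f 0) :
    ∀ᶠ x in μ.ae, f x = 0 := by
  have h : ∀ n : ℕ, ∀ᶠ x in μ.ae, f x < 1 / ((n : ℝ) + 1) := by
    intro n
    have hs : MeasurableSet {x | 1 / ((n : ℝ) + 1) ≤ f x} :=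
      measurableSet_le measurable_const hf.measurable
    have h1 : μ {x | 1 / ((n : ℝ) + 1) ≤ f x} = 0 := by
      refine le_antisymm ?_ (μ.nonneg' _ hs)
      have h2 := (HasPosIntegral.indicator (μ := μ) hs).smul (r := 1 / ((n : ℝ) + 1)) (by positivity)
      have h3 := h2.mono hμ hA hmul hf (fun x => by
        by_cases hx : 1 / ((n : ℝ) + 1) ≤ f x
        · rw [Pi.smul_apply, indicator_of_mem (s := {x | 1 / ((n : ℝ) + 1) ≤ f x}) hx]
          simpa using hx
        · rw [Pi.smul_apply, indicator_of_notMem (s := {x | 1 / ((n : ℝ) + 1) ≤ f x}) hx, smul_zero]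
          exact hf.nonneg_fun x)
      have h4 := smul_le_smul_of_nonneg_left h3 (by positivity : (0 : ℝ) ≤ (n : ℝ) + 1)
      rwa [smul_smul, mul_one_div_cancel (by positivity), one_smul, smul_zero] at h4
    filter_upwards [(μ.compl_mem_ae hs).2 h1] with x hx
    exact not_le.1 hx
  filter_upwards [μ.ae_all h] with x hx
  refine le_antisymm ?_ (hf.nonneg_fun x)
  exact ge_of_tendsto' tendsto_one_div_add_atTop_nhds_zero_nat fun n => (hx n).le

/-- The function equals its product with the indicator of a measurable null set `t`, so its integral
is `a * μ t = 0`. -/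
theorem HasPosIntegral.eq_zero (hμ : μ.IsSpectral) (hA : SigmaDedekindComplete A)
    (hmul : SigmaMonotoneContinuousMul A) {f : X → ℝ} {a : A} (hf : μ.HasPosIntegral f a)
    (h : ∀ᶠ x in μ.ae, f x = 0) : a = 0 := by
  obtain ⟨t, ht, h0, hsub⟩ := h
  have h1 : μ.HasPosIntegral f (a * μ t) := by
    convert hf.mul hμ hmul (.indicator ht) using 1
    ext x
    by_cases hx : x ∈ t
    · simp [hx]
    · have : f x = 0 := by
        by_contra h
        exact hx (hsub h)
      simp [this]
  rw [h0, mul_zero] at h1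
  exact hf.unique hμ hA hmul h1

end

end FiniteOrderMeasure

/-! ### The order integral of real-valued functions -/

namespace FiniteOrderMeasure

open MeasureTheory

section

variable {X : Type*} [MeasurableSpace X]
  {A : Type*} [Ring A] [Lattice A] [IsOrderedRing A] [Algebra ℝ A] [IsOrderedModule ℝ A]
  {μ : FiniteOrderMeasure X A}

/-- The integral may be computed from any decomposition into positive integrable functions, by
integrating `(f - g)⁺ + g = f + (f - g)⁻`. Linearity and multiplicativity then need no case analysis
on signs. -/
theorem HasPosIntegral.hasIntegral_sub (hμ : μ.IsSpectral) (hA : SigmaDedekindComplete A)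
    (hmul : SigmaMonotoneContinuousMul A) {f g : X → ℝ} {a b : A} (hf : μ.HasPosIntegral f a)
    (hg : μ.HasPosIntegral g b) : μ.HasIntegral (f - g) (a - b) := by
  have hm : Measurable (f - g) := hf.measurable.sub hg.measurable
  obtain ⟨c, hc⟩ := hf.exists_of_le hμ hA hmul (f := (f - g)⁺) (hm.sup measurable_const)
    (posPart_nonneg _) (sup_le (sub_le_self _ hg.nonneg_fun) hf.nonneg_fun)
  obtain ⟨d, hd⟩ := hg.exists_of_le hμ hA hmul (f := (f - g)⁻) (hm.neg.sup measurable_const)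
    (negPart_nonneg _) (sup_le (by rw [neg_sub]; exact sub_le_self _ hf.nonneg_fun) hg.nonneg_fun)
  refine ⟨c, d, hc, hd, ?_⟩
  have h := hc.add hg
  have h' : (f - g)⁺ + g = f + (f - g)⁻ := by
    have := posPart_sub_negPart (f - g)
    rw [sub_eq_sub_iff_add_eq_add] at this
    exact this
  rw [h'] at h
  exact sub_eq_sub_iff_add_eq_add.2 ((h.unique hμ hA hmul (hf.add hd)).symm)

theorem HasPosIntegral.hasIntegral (hμ : μ.IsSpectral) (hA : SigmaDedekindComplete A)
    (hmul : SigmaMonotoneContinuousMul A) {f : X → ℝ} {a : A} (hf : μ.HasPosIntegral f a) :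
    μ.HasIntegral f a := by
  have h0 : μ.HasPosIntegral (0 : X → ℝ) (0 : A) := by simpa using hf.smul le_rfl
  simpa using hf.hasIntegral_sub hμ hA hmul h0

namespace HasIntegral

theorem unique (hμ : μ.IsSpectral) (hA : SigmaDedekindComplete A)
    (hmul : SigmaMonotoneContinuousMul A) {f : X → ℝ} {a b : A} (ha : μ.HasIntegral f a)
    (hb : μ.HasIntegral f b) : a = b := by
  obtain ⟨c, d, hc, hd, rfl⟩ := ha
  obtain ⟨c', d', hc', hd', rfl⟩ := hb
  rw [hc.unique hμ hA hmul hc', hd.unique hμ hA hmul hd']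

theorem hasPosIntegral (hμ : μ.IsSpectral) (hA : SigmaDedekindComplete A)
    (hmul : SigmaMonotoneContinuousMul A) {f : X → ℝ} {a : A} (hf : μ.HasIntegral f a)
    (h0 : 0 ≤ f) : μ.HasPosIntegral f a := by
  have h := hf
  obtain ⟨b, c, hb, -, -⟩ := h
  rw [posPart_of_nonneg h0] at hb
  rwa [hf.unique hμ hA hmul (hb.hasIntegral hμ hA hmul)]

theorem add (hμ : μ.IsSpectral) (hA : SigmaDedekindComplete A)
    (hmul : SigmaMonotoneContinuousMul A) {f g : X → ℝ} {a b : A} (ha : μ.HasIntegral f a)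
    (hb : μ.HasIntegral g b) : μ.HasIntegral (f + g) (a + b) := by
  obtain ⟨c, d, hc, hd, rfl⟩ := ha
  obtain ⟨c', d', hc', hd', rfl⟩ := hb
  have h := (hc.add hc').hasIntegral_sub hμ hA hmul (hd.add hd')
  rwa [add_sub_add_comm, add_sub_add_comm, posPart_sub_negPart, posPart_sub_negPart] at h

theorem neg (hμ : μ.IsSpectral) (hA : SigmaDedekindComplete A)
    (hmul : SigmaMonotoneContinuousMul A) {f : X → ℝ} {a : A} (ha : μ.HasIntegral f a) :
    μ.HasIntegral (-f) (-a) := by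
  obtain ⟨c, d, hc, hd, rfl⟩ := ha
  have h := hd.hasIntegral_sub hμ hA hmul hc
  rwa [← neg_sub, posPart_sub_negPart, ← neg_sub] at h

theorem sub (hμ : μ.IsSpectral) (hA : SigmaDedekindComplete A)
    (hmul : SigmaMonotoneContinuousMul A) {f g : X → ℝ} {a b : A} (ha : μ.HasIntegral f a)
    (hb : μ.HasIntegral g b) : μ.HasIntegral (f - g) (a - b) := by
  simpa only [sub_eq_add_neg] using ha.add hμ hA hmul (hb.neg hμ hA hmul)

theorem smul (hμ : μ.IsSpectral) (hA : SigmaDedekindComplete A)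
    (hmul : SigmaMonotoneContinuousMul A) {f : X → ℝ} {a : A} (ha : μ.HasIntegral f a) (r : ℝ) :
    μ.HasIntegral (r • f) (r • a) := by
  have key : ∀ r : ℝ, 0 ≤ r → μ.HasIntegral (r • f) (r • a) := by
    intro r hr
    obtain ⟨c, d, hc, hd, rfl⟩ := ha
    have h := (hc.smul hr).hasIntegral_sub hμ hA hmul (hd.smul hr)
    rwa [← smul_sub, ← smul_sub, posPart_sub_negPart] at h
  rcases le_total 0 r with hr | hr
  · exact key r hr
  · simpa using (key (-r) (neg_nonneg.2 hr)).neg hμ hA hmul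

theorem mul (hμ : μ.IsSpectral) (hA : SigmaDedekindComplete A)
    (hmul : SigmaMonotoneContinuousMul A) {f g : X → ℝ} {a b : A} (ha : μ.HasIntegral f a)
    (hb : μ.HasIntegral g b) : μ.HasIntegral (f * g) (a * b) := by
  obtain ⟨c, d, hc, hd, rfl⟩ := ha
  obtain ⟨c', d', hc', hd', rfl⟩ := hb
  have h := ((hc.mul hμ hmul hc').add (hd.mul hμ hmul hd')).hasIntegral_sub hμ hA hmul
    ((hc.mul hμ hmul hd').add (hd.mul hμ hmul hc'))
  convert h using 1
  · conv_lhs => rw [← posPart_sub_negPart f, ← posPart_sub_negPart g]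
    ring
  · noncomm_ring

/-- The integrals of `f⁺` and `f⁻` are disjoint, so the modulus of their difference is their sum.
All lattice operations reduce to this case. -/
theorem abs (hμ : μ.IsSpectral) (hμe : μ univ ≤ 1) (hA : SigmaDedekindComplete A)
    (hmul : SigmaMonotoneContinuousMul A) {f : X → ℝ} {a : A} (ha : μ.HasIntegral f a) :
    μ.HasPosIntegral |f| |a| := by
  obtain ⟨c, d, hc, hd, rfl⟩ := ha
  have h1 : d ⊓ c = 0 := hd.inf_eq_zero hμ hμe hA hmul hc fun x => by
    rcases le_total 0 (f x) with h | h <;> simp [h]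
  have h2 : |c - d| = c + d := by
    rw [← sup_sub_inf_eq_abs_sub, h1, sub_zero, ← add_zero (d ⊔ c), ← h1, add_comm (d ⊔ c), inf_add_sup,
      add_comm]
  rw [h2, ← posPart_add_negPart]
  exact hc.add hd

theorem sup (hμ : μ.IsSpectral) (hμe : μ univ ≤ 1) (hA : SigmaDedekindComplete A)
    (hmul : SigmaMonotoneContinuousMul A) {f g : X → ℝ} {a b : A} (ha : μ.HasIntegral f a)
    (hb : μ.HasIntegral g b) : μ.HasIntegral (f ⊔ g) (a ⊔ b) := by
  rw [sup_eq_half_smul_add_add_abs_sub ℝ, sup_eq_half_smul_add_add_abs_sub ℝ]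
  exact ((ha.add hμ hA hmul hb).add hμ hA hmul
    (((hb.sub hμ hA hmul ha).abs hμ hμe hA hmul).hasIntegral hμ hA hmul)).smul hμ hA hmul _

theorem inf (hμ : μ.IsSpectral) (hμe : μ univ ≤ 1) (hA : SigmaDedekindComplete A)
    (hmul : SigmaMonotoneContinuousMul A) {f g : X → ℝ} {a b : A} (ha : μ.HasIntegral f a)
    (hb : μ.HasIntegral g b) : μ.HasIntegral (f ⊓ g) (a ⊓ b) := by
  have h := (ha.add hμ hA hmul hb).sub hμ hA hmul (ha.sup hμ hμe hA hmul hb)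
  rwa [← inf_add_sup, add_sub_cancel_right, ← inf_add_sup, add_sub_cancel_right] at h

theorem mul_univ (hμ : μ.IsSpectral) (hA : SigmaDedekindComplete A)
    (hmul : SigmaMonotoneContinuousMul A) {f : X → ℝ} {a : A} (h : μ.HasIntegral f a) :
    μ univ * a * μ univ = a := by
  obtain ⟨b, c, hb, hc, rfl⟩ := h
  rw [mul_sub, (hb.mul_univ hμ hA hmul).2, (hc.mul_univ hμ hA hmul).2, sub_mul,
    (hb.mul_univ hμ hA hmul).1, (hc.mul_univ hμ hA hmul).1]

theorem eq_zero_iff (hμ : μ.IsSpectral) (hμe : μ univ ≤ 1) (hA : SigmaDedekindComplete A)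
    (hmul : SigmaMonotoneContinuousMul A) {f : X → ℝ} {a : A} (h : μ.HasIntegral f a) :
    a = 0 ↔ ∀ᶠ x in μ.ae, f x = 0 := by
  have h1 := h.abs hμ hμe hA hmul
  constructor
  · rintro rfl
    rw [abs_zero] at h1
    filter_upwards [h1.eventually_eq_zero hμ hA hmul] with x hx
    simpa using hx
  · intro h0
    have h2 := h1.eq_zero hμ hA hmul (by filter_upwards [h0] with x hx; simpa using hx)
    exact le_antisymm (h2 ▸ le_abs_self a) (neg_nonpos.1 (h2 ▸ neg_le_abs a))

end HasIntegral

theorem integrable_iff (hμ : μ.IsSpectral) (hA : SigmaDedekindComplete A)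
    (hmul : SigmaMonotoneContinuousMul A) {f : X → ℝ} :
    μ.Integrable f ↔ ∃ a, μ.HasIntegral f a := by
  constructor
  · rintro ⟨hf, a, ha⟩
    obtain ⟨b, hb⟩ := ha.exists_of_le hμ hA hmul (f := f⁺) (hf.sup measurable_const)
      (posPart_nonneg _) (sup_le (le_abs_self f) (abs_nonneg f))
    obtain ⟨c, hc⟩ := ha.exists_of_le hμ hA hmul (f := f⁻) (hf.neg.sup measurable_const)
      (negPart_nonneg _) (sup_le (neg_le_abs f) (abs_nonneg f))
    exact ⟨b - c, b, c, hb, hc, rfl⟩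
  · rintro ⟨_, b, c, hb, hc, rfl⟩
    refine ⟨?_, b + c, ?_⟩
    · rw [← posPart_sub_negPart f]
      exact hb.measurable.sub hc.measurable
    · rw [← posPart_add_negPart]
      exact hb.add hc

theorem Integrable.of_abs_le (hμ : μ.IsSpectral) (hA : SigmaDedekindComplete A)
    (hmul : SigmaMonotoneContinuousMul A) {f g : X → ℝ} (hg : μ.Integrable g) (hf : Measurable f)
    (h : |f| ≤ |g|) : μ.Integrable f := by
  obtain ⟨-, a, ha⟩ := hg
  exact ⟨hf, ha.exists_of_le hμ hA hmul (hf.sup hf.neg) (abs_nonneg f) h⟩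

end

end FiniteOrderMeasure

/-! ### Injective vector lattice homomorphisms -/

section LatticeEmbedding

variable {E : Type*} [AddCommGroup E] [Module ℝ E] [Lattice E]
  {F : Type*} [AddCommGroup F] [Module ℝ F] [Lattice F] {J : E →ₗ[ℝ] F}

theorem map_le_map_iff_of_map_sup (hsup : ∀ a b, J (a ⊔ b) = J a ⊔ J b)
    (hinj : Function.Injective J) {a b : E} : J a ≤ J b ↔ a ≤ b := by
  rw [← sup_eq_right, ← hsup, hinj.eq_iff, sup_eq_right]

variable [IsOrderedAddMonoid E] [IsOrderedAddMonoid F]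

/-- A `σ`-order continuous operator preserves the suprema of increasing sequences. -/
theorem IsSigmaOrderContinuous.isLUB (hJ : IsSigmaOrderContinuous J) {x : ℕ → E} {a : E}
    (hx : Monotone x) (ha : IsLUB (range x) a) : IsLUB (range fun n => J (x n)) (J a) := by
  have h1 := ha.isGLB_range_sub a
  rw [sub_self] at h1
  have h2 := (hJ.2 _ (fun m n hmn => sub_le_sub_left (hx hmn) a) h1).2.isLUB_range_sub (J a)
  simpa using h2

/-- Makes the countably many indices of the countable sup property increasing, so that σ-order
continuity applies along them. -/
theorem exists_monotone_seq_ge {ι : Type*} [Preorder ι] [IsDirectedOrder ι] (s : ℕ → ι) :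
    ∃ t : ℕ → ι, Monotone t ∧ ∀ n, s n ≤ t n := by
  choose f hf using fun i j : ι => exists_ge_ge i j
  let t : ℕ → ι := fun n => Nat.rec (s 0) (fun n i => f i (s (n + 1))) n
  refine ⟨t, monotone_nat_of_le_succ fun n => (hf _ _).1, fun n => ?_⟩
  cases n with
  | zero => exact le_rfl
  | succ n => exact (hf _ _).2

variable (hE : SigmaDedekindComplete E) (hinj : Function.Injective J)
  (hsup : ∀ a b, J (a ⊔ b) = J a ⊔ J b) (hJ : IsSigmaOrderContinuous J)
  (hF : MonotoneComplete F) (hF' : CountableSupProperty F)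

include hE hinj hsup hJ hF hF'

/-- If a `σ`-Dedekind complete space `E` embeds `σ`-order continuously into a monotone complete
space with the countable sup property, then bounded increasing nets of positive elements of `E` have
suprema, which are attained along a sequence and are preserved by the embedding. -/
theorem exists_isLUB_range_of_embedding {ι : Type*} [Preorder ι] [IsDirectedOrder ι] [Nonempty ι]
    {x : ι → E} (h0 : ∀ i, 0 ≤ x i) (hx : Monotone x) (hb : BddAbove (range x)) :
    ∃ (y : E) (s : ℕ → ι), IsLUB (range x) y ∧ IsLUB (range fun n => x (s n)) y ∧
      IsLUB (range fun i => J (x i)) (J y) := by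
  have hmono : Monotone J := fun a b hab => (map_le_map_iff_of_map_sup hsup hinj).2 hab
  obtain ⟨h, hh⟩ := hb
  -- Reindexing the image net by its own range puts the index type in the universe of `F`, as the
  -- hypotheses on `F` demand.
  let R : Set F := range fun i => J (x i)
  have : Nonempty R := (range_nonempty _).to_subtype
  have : IsDirectedOrder R := ⟨by
    rintro ⟨_, i, rfl⟩ ⟨_, j, rfl⟩
    obtain ⟨k, hik, hjk⟩ := exists_ge_ge i j
    exact ⟨⟨_, k, rfl⟩, hmono (hx hik), hmono (hx hjk)⟩⟩
  obtain ⟨a, ha⟩ := hF R Subtype.val (fun _ _ h => h) ⟨J h, by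
    rintro _ ⟨⟨_, i, rfl⟩, rfl⟩
    exact hmono (hh ⟨i, rfl⟩)⟩
  obtain ⟨r, hr⟩ := hF' R Subtype.val a (by
    rintro ⟨_, i, rfl⟩
    exact hJ.1 _ (h0 i)) (fun _ _ h => h) ha
  rw [Subtype.range_val] at ha
  choose s hs using fun n => (r n).2
  obtain ⟨t, ht, hst⟩ := exists_monotone_seq_ge s
  have hat : IsLUB (range fun n => J (x (t n))) a := by
    refine ⟨?_, fun c hc => hr.2 ?_⟩
    · rintro _ ⟨n, rfl⟩
      exact ha.1 ⟨t n, rfl⟩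
    · rintro _ ⟨n, rfl⟩
      change (r n : F) ≤ c
      rw [← hs n]
      exact (hmono (hx (hst n))).trans (hc ⟨n, rfl⟩)
  obtain ⟨y, hy⟩ := hE (range fun n => x (t n)) (range_nonempty _) (countable_range _)
    ⟨h, by rintro _ ⟨n, rfl⟩; exact hh ⟨t n, rfl⟩⟩
  have hya : J y = a := (hJ.isLUB (hx.comp ht) hy).unique hat
  refine ⟨y, t, ⟨?_, fun c hc => hy.2 ?_⟩, hy, hya ▸ ha⟩
  · rintro _ ⟨i, rfl⟩
    -- To see `x i ≤ y`, compare images: `J (x i ⊔ y)` is the supremum of the `J (x i ⊔ x (t n))`,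
    -- each below some `J (x k)` and hence below `a = J y`.
    have h1 : IsLUB (range fun n => x i ⊔ x (t n)) (x i ⊔ y) := by
      refine ⟨?_, fun c hc => sup_le (le_sup_left.trans (hc ⟨0, rfl⟩)) (hy.2 ?_)⟩
      · rintro _ ⟨n, rfl⟩
        exact sup_le_sup_left (hy.1 ⟨n, rfl⟩) _
      · rintro _ ⟨n, rfl⟩
        exact le_sup_right.trans (hc ⟨n, rfl⟩)
    have h2 := hJ.isLUB (fun m n hmn => sup_le_sup_left (hx (ht hmn)) _) h1
    refine le_trans (b := x i ⊔ y) le_sup_left ?_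
    rw [← map_le_map_iff_of_map_sup hsup hinj, hya]
    refine h2.2 ?_
    rintro _ ⟨n, rfl⟩
    obtain ⟨k, hik, hjk⟩ := exists_ge_ge i (t n)
    exact (hmono (sup_le (hx hik) (hx hjk))).trans (ha.1 ⟨k, rfl⟩)
  · rintro _ ⟨n, rfl⟩
    exact hc ⟨t n, rfl⟩

theorem countableSupProperty_of_embedding : CountableSupProperty E := by
  intro ι _ _ _ x a h0 hx ha
  obtain ⟨y, s, hy, hs, -⟩ :=
    exists_isLUB_range_of_embedding hE hinj hsup hJ hF hF' h0 hx ⟨a, ha.1⟩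
  exact ⟨s, ha.unique hy ▸ hs⟩

theorem dedekindComplete_of_embedding : DedekindComplete E := by
  classical
  rintro S ⟨s, hs⟩ ⟨b, hb⟩
  -- Finite suprema form an increasing net; inserting `s` and subtracting it makes the net positive.
  let x : Finset S → E := fun T =>
    (insert ⟨s, hs⟩ T).sup' (Finset.insert_nonempty _ _) fun t => (t : E) - s
  obtain ⟨y, -, hy, -, -⟩ := exists_isLUB_range_of_embedding hE hinj hsup hJ hF hF' (x := x)
    (fun T => by
      refine le_trans ?_ (Finset.le_sup' _ (Finset.mem_insert_self _ _))
      simp)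
    (fun T U hTU => Finset.sup'_mono _ (Finset.insert_subset_insert _ hTU) _)
    ⟨b - s, by
      rintro _ ⟨T, rfl⟩
      exact Finset.sup'_le _ _ fun t _ => sub_le_sub_right (hb t.2) s⟩
  refine ⟨y + s, fun t ht => ?_, fun c hc => ?_⟩
  · rw [← sub_le_iff_le_add]
    refine le_trans ?_ (hy.1 ⟨{⟨t, ht⟩}, rfl⟩)
    exact Finset.le_sup' (fun t : S => (t : E) - s) (b := ⟨t, ht⟩) (by simp)
  · rw [← le_sub_iff_add_le]
    refine hy.2 ?_
    rintro _ ⟨T, rfl⟩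
    exact Finset.sup'_le _ _ fun t _ => sub_le_sub_right (hc t.2) s

theorem isOrderContinuous_of_embedding : IsOrderContinuous J := by
  have hmono : Monotone J := fun a b hab => (map_le_map_iff_of_map_sup hsup hinj).2 hab
  refine ⟨hJ.1, fun ι _ _ _ x hx h0 => ⟨fun i j hij => hmono (hx hij), ?_⟩⟩
  refine ⟨?_, fun c hc => ?_⟩
  · rintro _ ⟨i, rfl⟩
    exact hJ.1 _ (h0.1 ⟨i, rfl⟩)
  obtain ⟨i⟩ := ‹Nonempty ι›
  -- Beyond a fixed index `i` the differences `x i - x j` are positive and increase to `x i`, so the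
  -- result on suprema applies to them.
  have : IsDirectedOrder (Ici i) := ⟨by
    rintro ⟨j, hj⟩ ⟨k, hk⟩
    obtain ⟨l, hjl, hkl⟩ := exists_ge_ge j k
    exact ⟨⟨l, le_trans hj hjl⟩, hjl, hkl⟩⟩
  have h1 : IsGLB (range fun j : Ici i => x j) 0 := by
    refine ⟨?_, fun c hc => h0.2 ?_⟩
    · rintro _ ⟨j, rfl⟩
      exact h0.1 ⟨j, rfl⟩
    · rintro _ ⟨j, rfl⟩
      obtain ⟨k, hik, hjk⟩ := exists_ge_ge i j
      exact (hc ⟨⟨k, hik⟩, rfl⟩).trans (hx hjk)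
  have h2 := h1.isLUB_range_sub (x i)
  obtain ⟨y, -, hy, -, hJy⟩ := exists_isLUB_range_of_embedding hE hinj hsup hJ hF hF'
    (x := fun j : Ici i => x i - x j) (fun j => sub_nonneg.2 (hx j.2))
    (fun j k hjk => sub_le_sub_left (hx hjk) _) ⟨_, h2.1⟩
  rw [hy.unique h2, sub_zero] at hJy
  have h3 := hJy.isGLB_range_sub (J (x i))
  rw [sub_self] at h3
  refine h3.2 ?_
  rintro _ ⟨j, rfl⟩
  simpa using hc ⟨j, rfl⟩

end LatticeEmbedding

/-! ### Riesz subalgebras -/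

section RieszSubalgebra

variable {A : Type*} [NonUnitalRing A] [Module ℝ A] [Lattice A]

namespace RieszSubalgebra

variable (B : RieszSubalgebra A)

instance [IsOrderedAddMonoid A] : IsOrderedAddMonoid B where
  add_le_add_left _ _ hab c := add_le_add_left (α := A) hab c

theorem isRieszAlgebra (hA : IsRieszAlgebra A) : IsRieszAlgebra B where
  smul_mul_assoc r a b := Subtype.ext (hA.smul_mul_assoc r a b)
  mul_smul_comm r a b := Subtype.ext (hA.mul_smul_comm r a b)
  add_le_add_left a b hab c := hA.add_le_add_left a b hab c
  smul_nonneg r a hr ha := hA.smul_nonneg r a hr ha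
  mul_nonneg a b ha hb := hA.mul_nonneg a b ha hb
  archimedean a ha r hr h0 := by
    have h := hA.archimedean a ha r hr h0
    refine ⟨?_, fun b hb => show (b : A) ≤ 0 from h.2 ?_⟩
    · rintro _ ⟨n, rfl⟩
      exact h.1 ⟨n, rfl⟩
    · rintro _ ⟨n, rfl⟩
      exact hb ⟨n, rfl⟩

end RieszSubalgebra

variable {B : RieszSubalgebra A} {E : Type*} [AddCommGroup E] [Module ℝ E] [PartialOrder E]
  {T : E →ₗ[ℝ] A} {S : E →ₗ[ℝ] B}

theorem IsSigmaOrderContinuous.codRestrict (hT : IsSigmaOrderContinuous T)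
    (h : ∀ x, (S x : A) = T x) : IsSigmaOrderContinuous S := by
  refine ⟨fun x hx => show (0 : A) ≤ S x from h x ▸ hT.1 x hx, fun x hx h0 => ?_⟩
  obtain ⟨h1, h2⟩ := hT.2 x hx h0
  simp only [← h] at h1 h2
  refine ⟨h1, ?_, fun b hb => show (b : A) ≤ 0 from h2.2 ?_⟩
  · rintro _ ⟨n, rfl⟩
    exact h2.1 ⟨n, rfl⟩
  · rintro _ ⟨n, rfl⟩
    exact hb ⟨n, rfl⟩

theorem IsOrderContinuous.codRestrict (hT : IsOrderContinuous T)
    (h : ∀ x, (S x : A) = T x) : IsOrderContinuous S := by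
  refine ⟨fun x hx => show (0 : A) ≤ S x from h x ▸ hT.1 x hx, fun ι _ _ _ x hx h0 => ?_⟩
  obtain ⟨h1, h2⟩ := hT.2 ι x hx h0
  simp only [← h] at h1 h2
  refine ⟨h1, ?_, fun b hb => show (b : A) ≤ 0 from h2.2 ?_⟩
  · rintro _ ⟨n, rfl⟩
    exact h2.1 ⟨n, rfl⟩
  · rintro _ ⟨n, rfl⟩
    exact hb ⟨n, rfl⟩

end RieszSubalgebra

theorem SigmaDedekindComplete.isRieszAlgebra {A : Type*} [Ring A] [Lattice A] [IsOrderedRing A]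
    [Algebra ℝ A] [IsOrderedModule ℝ A] (hA : SigmaDedekindComplete A) : IsRieszAlgebra A where
  smul_mul_assoc := smul_mul_assoc
  mul_smul_comm := mul_smul_comm
  add_le_add_left a b hab c := by gcongr
  smul_nonneg _ _ := smul_nonneg
  mul_nonneg _ _ := mul_nonneg
  archimedean _ ha _ _ h0 := hA.isGLB_smul ha h0

theorem isRieszAlgebra_pi (X : Type*) : IsRieszAlgebra (X → ℝ) where
  smul_mul_assoc := smul_mul_assoc
  mul_smul_comm := mul_smul_comm
  add_le_add_left a b hab c := by gcongr
  smul_nonneg _ _ := smul_nonneg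
  mul_nonneg _ _ := mul_nonneg
  archimedean a ha r hr h0 := by
    have hr0 := tendsto_atTop_isGLB hr h0
    refine ⟨?_, fun b hb x => ?_⟩
    · rintro _ ⟨n, rfl⟩
      exact smul_nonneg (h0.1 ⟨n, rfl⟩) ha
    · have := hr0.mul_const (a x)
      rw [zero_mul] at this
      exact ge_of_tendsto' this fun n => hb ⟨n, rfl⟩ x

/-- The hypothesis `hl` serves the Archimedean property: countably many almost everywhere
inequalities must hold at once before passing to the limit pointwise. -/
theorem isRieszAlgebra_germ {X : Type*} (l : Filter X) (hl : ∀ p : ℕ → X → Prop,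
    (∀ n, ∀ᶠ x in l, p n x) → ∀ᶠ x in l, ∀ n, p n x) : IsRieszAlgebra (Germ l ℝ) where
  smul_mul_assoc r a b := by
    induction a, b using Germ.inductionOn₂ with | _ f g
    exact congrArg Germ.ofFun (smul_mul_assoc r f g)
  mul_smul_comm r a b := by
    induction a, b using Germ.inductionOn₂ with | _ f g
    exact congrArg Germ.ofFun (mul_smul_comm r f g)
  add_le_add_left a b hab c := by gcongr
  smul_nonneg r a hr ha := by
    induction a using Germ.inductionOn with | _ f
    exact Germ.coe_le.2 ((Germ.coe_le.1 ha).mono fun x hx => mul_nonneg hr hx)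
  mul_nonneg _ _ := mul_nonneg
  archimedean a ha r hr h0 := by
    have hr0 := tendsto_atTop_isGLB hr h0
    induction a using Germ.inductionOn with | _ f
    refine ⟨?_, fun b hb => ?_⟩
    · rintro _ ⟨n, rfl⟩
      exact Germ.coe_le.2 ((Germ.coe_le.1 ha).mono fun x hx => mul_nonneg (h0.1 ⟨n, rfl⟩) hx)
    · induction b using Germ.inductionOn with | _ g
      have h1 : ∀ n, ∀ᶠ x in l, g x ≤ r n * f x := fun n => Germ.coe_le.1 (hb ⟨n, rfl⟩)
      refine Germ.coe_le.2 ((hl _ h1).mono fun x hx => ?_)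
      have := hr0.mul_const (f x)
      rw [zero_mul] at this
      exact ge_of_tendsto' this hx

/-! ### Corners of Riesz algebras -/

namespace RieszSubalgebra

variable {A : Type*} [Ring A] [Lattice A] [IsOrderedRing A] {p : A}

theorem corner_mul_mul_le (h0 : 0 ≤ p) (h1 : p ≤ 1) {a : A} (ha : 0 ≤ a) : p * a * p ≤ a :=
  (mul_le_of_le_one_right (mul_nonneg h0 ha) h1).trans (mul_le_of_le_one_left ha h1)

theorem corner_mul_mul_mono (h0 : 0 ≤ p) {a b : A} (h : a ≤ b) : p * a * p ≤ p * b * p := by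
  gcongr

/-- The compression is monotone and fixes both `a` and `-a`, so `p * |a| * p` dominates `|a|`; it
never exceeds it since `p ≤ 1`. -/
theorem corner_mul_mul_abs (h0 : 0 ≤ p) (h1 : p ≤ 1) {a : A} (ha : p * a * p = a) :
    p * |a| * p = |a| := by
  refine le_antisymm (corner_mul_mul_le h0 h1 (abs_nonneg a)) (sup_le ?_ ?_)
  · conv_lhs => rw [← ha]
    exact corner_mul_mul_mono h0 (le_abs_self a)
  · conv_lhs => rw [← ha, ← neg_mul, ← mul_neg]
    exact corner_mul_mul_mono h0 (neg_le_abs a)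

/-- Compression decreases both `a` and `b - a` while preserving their sum `b`, so it fixes each of
them. -/
theorem corner_mul_mul_of_le (h0 : 0 ≤ p) (h1 : p ≤ 1) {a b : A} (ha : 0 ≤ a) (hab : a ≤ b)
    (hb : p * b * p = b) : p * a * p = a := by
  refine le_antisymm (corner_mul_mul_le h0 h1 ha) ?_
  have h := corner_mul_mul_le h0 h1 (sub_nonneg.2 hab)
  rw [mul_sub, sub_mul, hb] at h
  exact (sub_le_sub_iff_left b).1 h

variable [Algebra ℝ A]

/-- The corner `p A p` of an idempotent `p` with `0 ≤ p ≤ 1`. -/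
def corner (hp : p * p = p) (h0 : 0 ≤ p) (h1 : p ≤ 1) : RieszSubalgebra A where
  carrier := {a | p * a * p = a}
  add_mem' {a b} (ha : _ = _) (hb : _ = _) := show p * (a + b) * p = a + b by
    rw [mul_add, add_mul, ha, hb]
  zero_mem' := show p * 0 * p = 0 by simp
  mul_mem' {a b} (ha : _ = _) (hb : _ = _) := show p * (a * b) * p = a * b by
    have h2 : p * a = a := by rw [← ha, ← mul_assoc, ← mul_assoc, hp]
    have h3 : b * p = b := by rw [← hb, mul_assoc, hp]
    rw [← mul_assoc, h2, mul_assoc, h3]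
  smul_mem' r a (ha : _ = _) := show p * (r • a) * p = r • a by
    rw [mul_smul_comm, smul_mul_assoc, ha]
  sup_mem' {a b} (ha : _ = _) (hb : _ = _) := show p * (a ⊔ b) * p = a ⊔ b by
    have h : p * |b - a| * p = |b - a| := corner_mul_mul_abs h0 h1 (by
      rw [mul_sub, sub_mul, ha, hb])
    rw [sup_eq_half_smul_add_add_abs_sub ℝ, mul_smul_comm, smul_mul_assoc, mul_add, mul_add,
      add_mul, add_mul, ha, hb, h]
  inf_mem' {a b} (ha : _ = _) (hb : _ = _) := show p * (a ⊓ b) * p = a ⊓ b by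
    have h : p * |b - a| * p = |b - a| := corner_mul_mul_abs h0 h1 (by
      rw [mul_sub, sub_mul, ha, hb])
    rw [inf_eq_half_smul_add_sub_abs_sub ℝ, mul_smul_comm, smul_mul_assoc, mul_sub, mul_add,
      sub_mul, add_mul, ha, hb, h]

variable {hp : p * p = p} {h0 : 0 ≤ p} {h1 : p ≤ 1}

theorem mem_corner {a : A} : a ∈ corner hp h0 h1 ↔ p * a * p = a := Iff.rfl

theorem coe_corner : (corner hp h0 h1 : Set A) = {a | ∃ b, a = p * b * p} := by
  ext a
  refine ⟨fun h => ⟨a, (mem_corner.1 h).symm⟩, ?_⟩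
  rintro ⟨b, rfl⟩
  refine mem_corner.2 ?_
  rw [← mul_assoc, ← mul_assoc, hp, mul_assoc (p * b), hp]

theorem mem_corner_of_abs_le {a b : A} (hb : b ∈ corner hp h0 h1) (h : |a| ≤ |b|) :
    a ∈ corner hp h0 h1 := by
  have h2 := corner_mul_mul_abs h0 h1 (mem_corner.1 hb)
  have h3 := corner_mul_mul_of_le h0 h1 (posPart_nonneg a) ((sup_le (le_abs_self a)
    (abs_nonneg a)).trans h) h2
  have h4 := corner_mul_mul_of_le h0 h1 (negPart_nonneg a) ((sup_le (neg_le_abs a)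
    (abs_nonneg a)).trans h) h2
  rw [mem_corner, ← posPart_sub_negPart a, mul_sub, sub_mul, h3, h4]

theorem isProjectionBand_corner : IsProjectionBand (corner hp h0 h1).toSubmodule := by
  refine ⟨⟨fun b hb a hab => mem_corner_of_abs_le (hp := hp) (h0 := h0) (h1 := h1) hb hab,
    fun S hS ⟨s, hs⟩ a ha => ?_⟩, fun x => ⟨p * x * p, ?_, x - p * x * p, fun d hd => ?_, ?_⟩⟩
  · change p * a * p = a
    have hS' : ∀ t ∈ S, p * t * p = t := fun t ht => hS ht
    refine le_antisymm ?_ (ha.2 fun t ht => ?_)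
    -- The supremum `a` need not be positive, so the compression is compared on `a - s` for some `s`
    -- in `S`.
    · have h := corner_mul_mul_le h0 h1 (sub_nonneg.2 (ha.1 hs))
      rw [mul_sub, sub_mul, hS' s hs] at h
      exact (sub_le_sub_iff_right s).1 h
    · have h := corner_mul_mul_mono h0 (ha.1 ht)
      rwa [hS' t ht] at h
  · have : p * x * p ∈ (corner hp h0 h1 : Set A) := by
      rw [coe_corner]; exact ⟨x, rfl⟩
    exact this
  · set e := |x - p * x * p| ⊓ |d| with he
    have he0 : 0 ≤ e := le_inf (abs_nonneg _) (abs_nonneg _)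
    have h2 : p * e * p = e := corner_mul_mul_of_le h0 h1 he0 inf_le_right
      (corner_mul_mul_abs h0 h1 hd)
    -- `x ↦ x - p * x * p` is positive, hence its modulus is bounded by its value at `|x|`.
    -- Compression annihilates the bound but fixes `e`, which forces `e = 0`.
    have h3 : |x - p * x * p| ≤ |x| - p * |x| * p := by
      refine sup_le ?_ ?_
      · have := corner_mul_mul_le h0 h1 (sub_nonneg.2 (le_abs_self x))
        rw [mul_sub, sub_mul, ← sub_nonneg] at this
        rw [← sub_nonneg]
        convert this using 1
        abel
      · have := corner_mul_mul_le h0 h1 (sub_nonneg.2 (neg_le_abs x))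
        rw [mul_sub, sub_mul, mul_neg, neg_mul, ← sub_nonneg] at this
        rw [← sub_nonneg]
        convert this using 1
        abel
    refine le_antisymm ?_ he0
    rw [← h2]
    refine (corner_mul_mul_mono h0 (inf_le_left.trans h3)).trans ?_
    have : p * (p * |x| * p) * p = p * |x| * p := by
      rw [← mul_assoc, ← mul_assoc, hp, mul_assoc (p * |x|), hp]
    rw [mul_sub, sub_mul, this, sub_self]
  · abel

end RieszSubalgebra

/-! ### The spaces of integrable functions -/

namespace FiniteOrderMeasure

open MeasureTheory

variable {X : Type*} [MeasurableSpace X]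
  {A : Type*} [Ring A] [Lattice A] [IsOrderedRing A] [Algebra ℝ A] [IsOrderedModule ℝ A]
  {μ : FiniteOrderMeasure X A}

/-- The Riesz algebra `𝓛¹` of integrable functions. -/
def integrableFunctions (hμ : μ.IsSpectral) (hμe : μ univ ≤ 1) (hA : SigmaDedekindComplete A)
    (hmul : SigmaMonotoneContinuousMul A) : RieszSubalgebra (X → ℝ) where
  carrier := {f | μ.Integrable f}
  add_mem' {f g} hf hg := by
    obtain ⟨a, ha⟩ := (integrable_iff hμ hA hmul).1 hf
    obtain ⟨b, hb⟩ := (integrable_iff hμ hA hmul).1 hg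
    exact (integrable_iff hμ hA hmul).2 ⟨_, ha.add hμ hA hmul hb⟩
  zero_mem' := by
    have h : μ.HasPosIntegral (0 : X → ℝ) ((0 : ℝ) • μ univ) := HasPosIntegral.const 0
    exact (integrable_iff hμ hA hmul).2 ⟨_, h.hasIntegral hμ hA hmul⟩
  mul_mem' {f g} hf hg := by
    obtain ⟨a, ha⟩ := (integrable_iff hμ hA hmul).1 hf
    obtain ⟨b, hb⟩ := (integrable_iff hμ hA hmul).1 hg
    exact (integrable_iff hμ hA hmul).2 ⟨_, ha.mul hμ hA hmul hb⟩
  smul_mem' r f hf := by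
    obtain ⟨a, ha⟩ := (integrable_iff hμ hA hmul).1 hf
    exact (integrable_iff hμ hA hmul).2 ⟨_, ha.smul hμ hA hmul r⟩
  sup_mem' {f g} hf hg := by
    obtain ⟨a, ha⟩ := (integrable_iff hμ hA hmul).1 hf
    obtain ⟨b, hb⟩ := (integrable_iff hμ hA hmul).1 hg
    exact (integrable_iff hμ hA hmul).2 ⟨_, ha.sup hμ hμe hA hmul hb⟩
  inf_mem' {f g} hf hg := by
    obtain ⟨a, ha⟩ := (integrable_iff hμ hA hmul).1 hf
    obtain ⟨b, hb⟩ := (integrable_iff hμ hA hmul).1 hg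
    exact (integrable_iff hμ hA hmul).2 ⟨_, ha.inf hμ hμe hA hmul hb⟩

/-- The Riesz algebra `L¹` of classes of integrable functions modulo equality almost everywhere. -/
def integrableGerms (hμ : μ.IsSpectral) (hμe : μ univ ≤ 1) (hA : SigmaDedekindComplete A)
    (hmul : SigmaMonotoneContinuousMul A) : RieszSubalgebra (Germ μ.ae ℝ) where
  carrier := {g | ∃ f : X → ℝ, μ.Integrable f ∧ g = (f : Germ μ.ae ℝ)}
  add_mem' := by
    rintro _ _ ⟨f, hf, rfl⟩ ⟨g, hg, rfl⟩
    exact ⟨f + g, (integrableFunctions hμ hμe hA hmul).add_mem' hf hg, rfl⟩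
  zero_mem' := ⟨0, (integrableFunctions hμ hμe hA hmul).zero_mem', rfl⟩
  mul_mem' := by
    rintro _ _ ⟨f, hf, rfl⟩ ⟨g, hg, rfl⟩
    exact ⟨f * g, (integrableFunctions hμ hμe hA hmul).mul_mem' hf hg, rfl⟩
  smul_mem' := by
    rintro r _ ⟨f, hf, rfl⟩
    exact ⟨r • f, (integrableFunctions hμ hμe hA hmul).smul_mem' r hf, rfl⟩
  sup_mem' := by
    rintro _ _ ⟨f, hf, rfl⟩ ⟨g, hg, rfl⟩
    exact ⟨f ⊔ g, (integrableFunctions hμ hμe hA hmul).sup_mem' hf hg, rfl⟩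
  inf_mem' := by
    rintro _ _ ⟨f, hf, rfl⟩ ⟨g, hg, rfl⟩
    exact ⟨f ⊓ g, (integrableFunctions hμ hμe hA hmul).inf_mem' hf hg, rfl⟩

theorem HasIntegral.eq_of_eventuallyEq (hμ : μ.IsSpectral) (hμe : μ univ ≤ 1)
    (hA : SigmaDedekindComplete A) (hmul : SigmaMonotoneContinuousMul A) {f g : X → ℝ} {a b : A}
    (hf : μ.HasIntegral f a) (hg : μ.HasIntegral g b) (h : f =ᶠ[μ.ae] g) : a = b := by
  rw [← sub_eq_zero, (hf.sub hμ hA hmul hg).eq_zero_iff hμ hμe hA hmul]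
  filter_upwards [h] with x hx
  simp [hx]

/-- A function that is almost everywhere equal to an integrable function has the same integral as
soon as it is measurable and dominated. -/
theorem HasIntegral.congr_of_abs_le (hμ : μ.IsSpectral) (hμe : μ univ ≤ 1)
    (hA : SigmaDedekindComplete A) (hmul : SigmaMonotoneContinuousMul A) {f g : X → ℝ} {a : A}
    (hf : μ.HasIntegral f a) (hg : Measurable g) (hgf : |g| ≤ |f|) (h : f =ᶠ[μ.ae] g) :
    μ.HasIntegral g a := by
  obtain ⟨b, hb⟩ := (integrable_iff hμ hA hmul).1
    (((integrable_iff hμ hA hmul).2 ⟨a, hf⟩).of_abs_le hμ hA hmul hg hgf)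
  rwa [hf.eq_of_eventuallyEq hμ hμe hA hmul hb h]

/-! ### The integral on `L¹`: injectivity, completeness, continuity -/

section Maps

variable (hμ : μ.IsSpectral) (hμe : μ univ ≤ 1) (hA : SigmaDedekindComplete A)
  (hmul : SigmaMonotoneContinuousMul A)

theorem exists_hasIntegral_of_germ (g : integrableGerms hμ hμe hA hmul) :
    ∃ a, ∃ f : X → ℝ, (g : Germ μ.ae ℝ) = f ∧ μ.HasIntegral f a := by
  obtain ⟨f, hf, hgf⟩ := g.2
  obtain ⟨a, ha⟩ := (integrable_iff hμ hA hmul).1 hf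
  exact ⟨a, f, hgf, ha⟩

/-- The order integral on `L¹`. -/
noncomputable def germIntegral : integrableGerms hμ hμe hA hmul →ₗ[ℝ] A :=
  -- The chosen value is the integral of every integrable representative, so linearity may be
  -- checked on convenient ones.
  have key : ∀ (g : integrableGerms hμ hμe hA hmul) {f : X → ℝ} {a : A}, (g : Germ μ.ae ℝ) = f → μ.HasIntegral f a →
      (exists_hasIntegral_of_germ hμ hμe hA hmul g).choose = a := fun g f a hg ha => by
    obtain ⟨f', hf', ha'⟩ := (exists_hasIntegral_of_germ hμ hμe hA hmul g).choose_spec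
    exact ha'.eq_of_eventuallyEq hμ hμe hA hmul ha (Germ.coe_eq.1 (hf'.symm.trans hg))
  { toFun g := (exists_hasIntegral_of_germ hμ hμe hA hmul g).choose
    map_add' g h := by
      obtain ⟨f, hf, ha⟩ := (exists_hasIntegral_of_germ hμ hμe hA hmul g).choose_spec
      obtain ⟨f', hf', ha'⟩ := (exists_hasIntegral_of_germ hμ hμe hA hmul h).choose_spec
      exact key (g + h) (f := f + f') (congrArg₂ (· + ·) hf hf') (ha.add hμ hA hmul ha')
    map_smul' r g := by
      obtain ⟨f, hf, ha⟩ := (exists_hasIntegral_of_germ hμ hμe hA hmul g).choose_spec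
      exact key (r • g) (f := r • f) (congrArg (r • ·) hf) (ha.smul hμ hA hmul r) }

variable {hμ hμe hA hmul}

theorem germIntegral_eq {g : integrableGerms hμ hμe hA hmul} {f : X → ℝ} {a : A}
    (hg : (g : Germ μ.ae ℝ) = f) (ha : μ.HasIntegral f a) : germIntegral hμ hμe hA hmul g = a := by
  obtain ⟨f', hf', ha'⟩ := (exists_hasIntegral_of_germ hμ hμe hA hmul g).choose_spec
  exact ha'.eq_of_eventuallyEq hμ hμe hA hmul ha (Germ.coe_eq.1 (hf'.symm.trans hg))

theorem exists_hasIntegral_germIntegral (g : integrableGerms hμ hμe hA hmul) :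
    ∃ f : X → ℝ, (g : Germ μ.ae ℝ) = f ∧ μ.HasIntegral f (germIntegral hμ hμe hA hmul g) :=
  (exists_hasIntegral_of_germ hμ hμe hA hmul g).choose_spec

theorem isRieszAlgebraHom_germIntegral : IsRieszAlgebraHom (germIntegral hμ hμe hA hmul) where
  map_mul g h := by
    obtain ⟨f, hf, ha⟩ := exists_hasIntegral_germIntegral g
    obtain ⟨f', hf', ha'⟩ := exists_hasIntegral_germIntegral h
    exact germIntegral_eq (g := g * h) (congrArg₂ (· * ·) hf hf') (ha.mul hμ hA hmul ha')
  map_sup g h := by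
    obtain ⟨f, hf, ha⟩ := exists_hasIntegral_germIntegral g
    obtain ⟨f', hf', ha'⟩ := exists_hasIntegral_germIntegral h
    exact germIntegral_eq (g := g ⊔ h) (congrArg₂ (· ⊔ ·) hf hf') (ha.sup hμ hμe hA hmul ha')
  map_inf g h := by
    obtain ⟨f, hf, ha⟩ := exists_hasIntegral_germIntegral g
    obtain ⟨f', hf', ha'⟩ := exists_hasIntegral_germIntegral h
    exact germIntegral_eq (g := g ⊓ h) (congrArg₂ (· ⊓ ·) hf hf') (ha.inf hμ hμe hA hmul ha')

theorem injective_germIntegral : Function.Injective (germIntegral hμ hμe hA hmul) := by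
  rw [injective_iff_map_eq_zero]
  intro g hg
  obtain ⟨f, hf, ha⟩ := exists_hasIntegral_germIntegral g
  have h := (ha.eq_zero_iff hμ hμe hA hmul).1 hg
  exact Subtype.ext (hf.trans (Germ.coe_eq.2 h))

theorem germIntegral_nonneg {g : integrableGerms hμ hμe hA hmul} (hg : 0 ≤ g) :
    0 ≤ germIntegral hμ hμe hA hmul g := by
  rw [← map_zero (germIntegral hμ hμe hA hmul)]
  exact (map_le_map_iff_of_map_sup isRieszAlgebraHom_germIntegral.map_sup
    injective_germIntegral).2 hg

/-- A pointwise supremum of representatives is measurable, and countably many exceptional null sets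
do no harm. -/
theorem sigmaDedekindComplete_integrableGerms :
    SigmaDedekindComplete (integrableGerms hμ hμe hA hmul) := by
  rintro S hS hSc ⟨b, hb⟩
  obtain ⟨s, rfl⟩ := hSc.exists_eq_range hS
  choose f hf hfs using fun n => (s n).2
  obtain ⟨h, hh, hbh⟩ := b.2
  -- Truncation by a representative `h` of the upper bound makes the supremum finite at every point
  -- and changes each `f n` only on a null set. Then `f 0 ⊓ h ≤ F ≤ h` gives integrability.
  let F : X → ℝ := fun x => ⨆ n, f n x ⊓ h x
  have hbdd : ∀ x, BddAbove (range fun n => f n x ⊓ h x) := fun x =>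
    ⟨h x, by rintro _ ⟨n, rfl⟩; exact inf_le_right⟩
  have hFm : Measurable F := Measurable.iSup fun n => (hf n).1.inf hh.1
  have hFh : ∀ x, F x ≤ h x := fun x => ciSup_le fun n => inf_le_right
  have hfF : ∀ n x, f n x ⊓ h x ≤ F x := fun n x => le_ciSup (hbdd x) n
  have hF : μ.Integrable F := by
    have h1 : μ.Integrable ((f 0 ⊓ h) ⊔ -(f 0 ⊓ h) + (h ⊔ -h)) := by
      let L := integrableFunctions hμ hμe hA hmul
      have h2 : f 0 ⊓ h ∈ L := L.inf_mem' (hf 0) hh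
      have h3 : h ∈ L := hh
      exact add_mem (S := RieszSubalgebra (X → ℝ)) (s := L) (L.sup_mem' h2 (neg_mem h2))
        (L.sup_mem' h3 (neg_mem h3))
    refine h1.of_abs_le hμ hA hmul hFm fun x => ?_
    change |F x| ≤ |(|f 0 x ⊓ h x| + |h x|)|
    rw [abs_of_nonneg (a := |f 0 x ⊓ h x| + |h x|) (by positivity), abs_le]
    constructor
    · linarith [neg_abs_le (f 0 x ⊓ h x), abs_nonneg (h x), hfF 0 x]
    · linarith [le_abs_self (h x), abs_nonneg (f 0 x ⊓ h x), hFh x]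
  have hle : ∀ n, f n ≤ᶠ[μ.ae] h := fun n => by
    have h1 : (s n : Germ μ.ae ℝ) ≤ b := hb ⟨n, rfl⟩
    rw [hfs n, hbh] at h1
    exact Germ.coe_le.1 h1
  refine ⟨⟨F, F, hF, rfl⟩, ?_, fun c hc => ?_⟩
  · rintro _ ⟨n, rfl⟩
    change (s n : Germ μ.ae ℝ) ≤ F
    rw [hfs n, Germ.coe_le]
    filter_upwards [hle n] with x hx
    exact (le_inf le_rfl hx).trans (hfF n x)
  · obtain ⟨k, hk, hck⟩ := c.2
    change (F : Germ μ.ae ℝ) ≤ c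
    rw [hck, Germ.coe_le]
    have h1 : ∀ n, ∀ᶠ x in μ.ae, f n x ≤ k x := fun n => by
      have h2 : (s n : Germ μ.ae ℝ) ≤ c := hc ⟨n, rfl⟩
      rw [hfs n, hck] at h2
      exact Germ.coe_le.1 h2
    filter_upwards [μ.ae_all h1] with x hx
    exact ciSup_le fun n => inf_le_left.trans (hx n)

theorem isSigmaOrderContinuous_germIntegral :
    IsSigmaOrderContinuous (germIntegral hμ hμe hA hmul) := by
  refine ⟨fun g => germIntegral_nonneg, fun s hs h0 => ⟨fun m n hmn => ?_, ?_⟩⟩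
  · exact (map_le_map_iff_of_map_sup isRieszAlgebraHom_germIntegral.map_sup
      injective_germIntegral).2 (hs hmn)
  set J := germIntegral hμ hμe hA hmul with hJ
  choose f hfs hf using fun n => exists_hasIntegral_germIntegral (s n)
  have hf0 : ∀ n, ∀ᶠ x in μ.ae, 0 ≤ f n x ∧ f (n + 1) x ≤ f n x := fun n => by
    have h1 : (0 : Germ μ.ae ℝ) ≤ s n := h0.1 ⟨n, rfl⟩
    have h2 : (s (n + 1) : Germ μ.ae ℝ) ≤ s n := hs n.le_succ
    rw [hfs] at h1
    rw [hfs, hfs] at h2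
    exact (Germ.coe_le.1 h1).and (Germ.coe_le.1 h2)
  obtain ⟨t, ht, ht0, hsub⟩ := μ.ae_all hf0
  have hsub' : ∀ x ∉ t, ∀ n, 0 ≤ f n x ∧ f (n + 1) x ≤ f n x := fun x hx => by
    by_contra h
    exact hx (hsub h)
  -- Cutting off on the null set `t` makes the representatives positive and decreasing everywhere.
  let k : ℕ → X → ℝ := fun n => tᶜ.indicator (f n)
  have hfk : ∀ n, f n =ᶠ[μ.ae] k n := fun n => by
    filter_upwards [(μ.compl_mem_ae ht).2 ht0] with x hx
    exact (indicator_of_mem hx _).symm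
  have hk : ∀ n, μ.HasIntegral (k n) (J (s n)) := fun n => by
    refine (hf n).congr_of_abs_le hμ hμe hA hmul
      (((integrable_iff hμ hA hmul).2 ⟨_, hf n⟩).1.indicator ht.compl) (fun x => ?_) (hfk n)
    by_cases hx : x ∈ t <;> simp [k, hx]
  have hk0 : ∀ n, 0 ≤ k n := fun n => indicator_nonneg fun x hx => (hsub' x hx n).1
  have hkanti : Antitone k := antitone_nat_of_succ_le fun n x => by
    by_cases hx : x ∈ t
    · simp [k, hx]
    · simpa [k, hx] using (hsub' x hx n).2
  have hbdd : ∀ x, BddBelow (range fun n => k n x) := fun x =>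
    ⟨0, by rintro _ ⟨n, rfl⟩; exact hk0 n x⟩
  let g : X → ℝ := fun x => ⨅ n, k n x
  have hg0 : 0 ≤ g := fun x => le_ciInf fun n => hk0 n x
  have hgk : ∀ n, g ≤ k n := fun n x => ciInf_le (hbdd x) n
  have hkint : ∀ n, μ.Integrable (k n) := fun n => (integrable_iff hμ hA hmul).2 ⟨_, hk n⟩
  have hgint : μ.Integrable g := (hkint 0).of_abs_le hμ hA hmul
    (Measurable.iInf fun n => (hkint n).1) (by
      rw [abs_of_nonneg hg0, abs_of_nonneg (hk0 0)]
      exact hgk 0)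
  -- The class of the pointwise infimum is a lower bound of the sequence in `L¹`, whose infimum is
  -- `0`; hence `g` is null.
  have hgle : (⟨g, g, hgint, rfl⟩ : integrableGerms hμ hμe hA hmul) ≤ 0 := h0.2 (by
    rintro _ ⟨n, rfl⟩
    change (g : Germ μ.ae ℝ) ≤ s n
    rw [hfs n, Germ.coe_le]
    filter_upwards [hfk n] with x hx
    exact hx ▸ hgk n x)
  have hgnull : ∀ᶠ x in μ.ae, g x = 0 := by
    have h1 : (g : Germ μ.ae ℝ) ≤ ((0 : X → ℝ) : Germ μ.ae ℝ) := hgle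
    filter_upwards [Germ.coe_le.1 h1] with x hx
    exact le_antisymm hx (hg0 x)
  obtain ⟨c, hc⟩ := (integrable_iff hμ hA hmul).1 hgint
  obtain rfl : c = 0 := (hc.eq_zero_iff hμ hμe hA hmul).2 hgnull
  -- Monotone convergence is applied to `k 0 - k n`, which increases to `k 0 - g`.
  have hlub : IsLUB (range fun n => J (s 0) - J (s n)) (J (s 0) - 0) := by
    refine HasPosIntegral.isLUB_of_tendsto hμ hA hmul (f := fun n => k 0 - k n) (g := k 0 - g)
      (fun n => ?_) ?_ (fun m n hmn => sub_le_sub_left (hkanti hmn) _) fun x => ?_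
    · exact ((hk 0).sub hμ hA hmul (hk n)).hasPosIntegral hμ hA hmul
        (sub_nonneg.2 (hkanti n.zero_le))
    · exact ((hk 0).sub hμ hA hmul hc).hasPosIntegral hμ hA hmul (sub_nonneg.2 (hgk 0))
    · exact (tendsto_atTop_ciInf (fun m n hmn => hkanti hmn x) (hbdd x)).const_sub _
  simpa using hlub.isGLB_range_sub (J (s 0))

end Maps

end FiniteOrderMeasure

/-! ### The image of the order integral -/

namespace FiniteOrderMeasure

open MeasureTheory

theorem IsSpectral.univ_mul_univ {X : Type*} [MeasurableSpace X] {A : Type*} [Ring A] [Lattice A]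
    {μ : FiniteOrderMeasure X A} (hμ : μ.IsSpectral) : μ univ * μ univ = μ univ := by
  rw [← hμ univ univ .univ .univ, inter_self]

variable {X : Type*} [MeasurableSpace X]
  {A : Type*} [Ring A] [Lattice A] [IsOrderedRing A] [Algebra ℝ A] [IsOrderedModule ℝ A]
  {μ : FiniteOrderMeasure X A}

/-- The Riesz subalgebra `μ(X) A μ(X)`. -/
def IsSpectral.corner (hμ : μ.IsSpectral) (hμe : μ univ ≤ 1) : RieszSubalgebra A :=
  RieszSubalgebra.corner hμ.univ_mul_univ (μ.nonneg' univ .univ) hμe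

theorem HasIntegral.mem_corner (hμ : μ.IsSpectral) (hμe : μ univ ≤ 1)
    (hA : SigmaDedekindComplete A) (hmul : SigmaMonotoneContinuousMul A) {f : X → ℝ} {a : A}
    (h : μ.HasIntegral f a) : a ∈ hμ.corner hμe :=
  h.mul_univ hμ hA hmul

theorem integrable_of_bounded (hμ : μ.IsSpectral) (hA : SigmaDedekindComplete A)
    (hmul : SigmaMonotoneContinuousMul A) {f : X → ℝ} (hf : Measurable f) {C : ℝ}
    (hC : ∀ x, |f x| ≤ C) : μ.Integrable f := by
  have h : μ.HasPosIntegral (fun _ => (C.toNNReal : ℝ)) _ := HasPosIntegral.const C.toNNReal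
  exact ⟨hf, h.exists_of_le hμ hA hmul (hf.sup hf.neg) (abs_nonneg f)
    fun x => (hC x).trans (Real.le_coe_toNNReal C)⟩

theorem HasIntegral.abs_le_smul (hμ : μ.IsSpectral) (hμe : μ univ ≤ 1)
    (hA : SigmaDedekindComplete A) (hmul : SigmaMonotoneContinuousMul A) {f : X → ℝ} {a : A}
    (h : μ.HasIntegral f a) {C : ℝ≥0} (hC : ∀ x, |f x| ≤ C) : |a| ≤ (C : ℝ) • μ univ :=
  (h.abs hμ hμe hA hmul).mono hμ hA hmul (HasPosIntegral.const C) hC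

/-! ### Locating integrals in order ideals of the corner -/

section Ideals

variable {hμ : μ.IsSpectral} {hμe : μ univ ≤ 1} {I : Submodule ℝ (hμ.corner hμe)}
  {p b : hμ.corner hμe} {f : X → ℝ}

theorem HasIntegral.mem_of_isOrderIdeal (hA : SigmaDedekindComplete A)
    (hmul : SigmaMonotoneContinuousMul A) (hI : IsOrderIdeal I) (hp : (p : A) = μ univ)
    (hpI : p ∈ I) (h : μ.HasIntegral f b) {C : ℝ} (hC : ∀ x, |f x| ≤ C) : b ∈ I := by
  refine hI (I.smul_mem (C.toNNReal : ℝ) hpI) ?_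
  have h1 := h.abs_le_smul hμ hμe hA hmul fun x => (hC x).trans (Real.le_coe_toNNReal C)
  rw [← hp] at h1
  exact h1.trans (le_abs_self ((C.toNNReal : ℝ) • (p : A)))

theorem HasPosIntegral.mem_of_isSigmaOrderIdeal (hA : SigmaDedekindComplete A)
    (hmul : SigmaMonotoneContinuousMul A) (hI : IsSigmaOrderIdeal I) (hp : (p : A) = μ univ)
    (hpI : p ∈ I) (h : μ.HasPosIntegral f b) : b ∈ I := by
  obtain ⟨φ, -, -, hφ⟩ := h
  have hint : ∀ n, μ.HasIntegral (fun x => (φ n x : ℝ)) (μ.elementaryIntegral (φ n)) := fun n =>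
    (HasPosIntegral.const_fun (φ n)).hasIntegral hμ hA hmul
  let s : ℕ → hμ.corner hμe := fun n => ⟨_, (hint n).mem_corner hμ hμe hA hmul⟩
  -- Elementary functions are bounded, so their integrals lie in the ideal. A supremum in `A` that
  -- belongs to the corner is also a supremum in the corner.
  refine hI.2 (range s) ?_ (range_nonempty s) (countable_range s) b ⟨?_, fun c hc => hφ.2 ?_⟩
  · rintro _ ⟨n, rfl⟩
    rcases isEmpty_or_nonempty X with hX | hX
    · exact (hint n).mem_of_isOrderIdeal (b := s n) hA hmul hI.1 hp hpI (C := 0)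
        fun x => isEmptyElim x
    · obtain ⟨C, hC⟩ := (φ n).exists_forall_le
      refine (hint n).mem_of_isOrderIdeal (b := s n) hA hmul hI.1 hp hpI (C := C) fun x => ?_
      rw [NNReal.abs_eq]
      exact hC x
  · rintro _ ⟨n, rfl⟩
    exact hφ.1 ⟨n, rfl⟩
  · rintro _ ⟨n, rfl⟩
    exact hc ⟨n, rfl⟩

theorem HasIntegral.mem_of_isSigmaOrderIdeal (hA : SigmaDedekindComplete A)
    (hmul : SigmaMonotoneContinuousMul A) (hI : IsSigmaOrderIdeal I) (hp : (p : A) = μ univ)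
    (hpI : p ∈ I) (h : μ.HasIntegral f b) : b ∈ I := by
  obtain ⟨c, d, hc, hd, hb⟩ := h
  let c' : hμ.corner hμe := ⟨c, (hc.hasIntegral hμ hA hmul).mem_corner hμ hμe hA hmul⟩
  let d' : hμ.corner hμe := ⟨d, (hd.hasIntegral hμ hA hmul).mem_corner hμ hμe hA hmul⟩
  have hbc : b = c' - d' := Subtype.ext hb
  rw [hbc]
  exact I.sub_mem (hc.mem_of_isSigmaOrderIdeal (b := c') hA hmul hI hp hpI)
    (hd.mem_of_isSigmaOrderIdeal (b := d') hA hmul hI hp hpI)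

end Ideals

variable (hμ : μ.IsSpectral) (hμe : μ univ ≤ 1) (hA : SigmaDedekindComplete A)
  (hmul : SigmaMonotoneContinuousMul A)

/-- The quotient map from `𝓛¹` to `L¹`. -/
def toIntegrableGerms :
    integrableFunctions hμ hμe hA hmul →ₗ[ℝ] integrableGerms hμ hμe hA hmul where
  toFun f := ⟨((f : X → ℝ) : Germ μ.ae ℝ), f, f.2, rfl⟩
  map_add' _ _ := rfl
  map_smul' _ _ := rfl

/-- The order integral on `L¹` with codomain `μ(X) A μ(X)`. -/
noncomputable def germIntegralCorner : integrableGerms hμ hμe hA hmul →ₗ[ℝ] hμ.corner hμe where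
  toFun g := ⟨germIntegral hμ hμe hA hmul g, by
    obtain ⟨f, -, hf⟩ := exists_hasIntegral_germIntegral g
    exact hf.mem_corner hμ hμe hA hmul⟩
  map_add' g h := Subtype.ext (map_add (germIntegral hμ hμe hA hmul) g h)
  map_smul' r g := Subtype.ext (map_smul (germIntegral hμ hμe hA hmul) r g)

theorem isRieszAlgebraHom_toIntegrableGerms :
    IsRieszAlgebraHom (toIntegrableGerms hμ hμe hA hmul) :=
  ⟨fun _ _ => rfl, fun _ _ => rfl, fun _ _ => rfl⟩

theorem hasIntegral_iff (f : integrableFunctions hμ hμe hA hmul) (a : A) :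
    μ.HasIntegral f a ↔
      germIntegral hμ hμe hA hmul (toIntegrableGerms hμ hμe hA hmul f) = a := by
  have key : ∀ a, μ.HasIntegral f a →
      germIntegral hμ hμe hA hmul (toIntegrableGerms hμ hμe hA hmul f) = a := fun a ha =>
    germIntegral_eq (g := toIntegrableGerms hμ hμe hA hmul f) rfl ha
  refine ⟨key a, ?_⟩
  rintro rfl
  obtain ⟨b, hb⟩ := (integrable_iff hμ hA hmul).1 f.2
  rwa [key b hb]

end FiniteOrderMeasure

open FiniteOrderMeasure

/-- In the conclusion, `B` is `μ(X) A μ(X)`, `L` is the space `𝓛¹` of integrable functions, `I` is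
the order integral on `L`, and `IB` is `I` with codomain `B`. Furthermore, `L1` is the quotient `L¹`
of `𝓛¹` modulo the almost everywhere vanishing functions, realised as the classes of integrable
functions modulo equality almost everywhere, with quotient map `π`, and `J`, `JB` are the maps on
`L¹` that are induced by `I`, `IB`. -/
theorem mainTheorem9 {X : Type*} [MeasurableSpace X]
    {A : Type*} [Ring A] [Lattice A] [IsOrderedRing A] [Algebra ℝ A] [IsOrderedModule ℝ A]
    (hA : SigmaDedekindComplete A) (hmul : SigmaMonotoneContinuousMul A)
    (μ : FiniteOrderMeasure X A) (hμ : μ.IsSpectral) (hμe : μ univ ≤ 1) :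
    ∃ (B : RieszSubalgebra A) (L : RieszSubalgebra (X → ℝ)) (I : L →ₗ[ℝ] A) (IB : L →ₗ[ℝ] B)
      (L1 : RieszSubalgebra (Germ μ.ae ℝ)) (π : L →ₗ[ℝ] L1) (J : L1 →ₗ[ℝ] A) (JB : L1 →ₗ[ℝ] B),
      -- `μ(X) A μ(X)` is a Riesz subalgebra and a projection band
      (B : Set A) = {a | ∃ b, a = μ univ * b * μ univ} ∧
      IsRieszAlgebra B ∧
      IsProjectionBand B.toSubmodule ∧
      -- `𝓛¹` is a unital Riesz algebra, and the integral is a Riesz algebra homomorphism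
      (L : Set (X → ℝ)) = {f | μ.Integrable f} ∧
      (1 : X → ℝ) ∈ L ∧
      IsRieszAlgebra L ∧
      (∀ (f : L) (a : A), μ.HasIntegral f a ↔ I f = a) ∧
      IsRieszAlgebraHom I ∧
      -- the ideals in `μ(X) A μ(X)` that contain the images
      (∀ f : L, (IB f : A) = I f) ∧
      (∃ p : B, (p : A) = μ univ ∧
        (∀ f : X → ℝ, Measurable f → (∃ C : ℝ, ∀ x, |f x| ≤ C) →
          ∃ hf : f ∈ L, IB ⟨f, hf⟩ ∈ orderIdealSpan {p}) ∧
        (∀ f : L, IB f ∈ sigmaOrderIdealSpan {p})) ∧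
      -- the kernel of the integral consists of the functions that vanish almost everywhere
      (∀ f : L, I f = 0 ↔ ∀ᶠ x in μ.ae, (f : X → ℝ) x = 0) ∧
      -- `L¹` is a commutative unital Riesz algebra, the quotient of `𝓛¹`
      (L1 : Set (Germ μ.ae ℝ)) = {g | ∃ f : X → ℝ, μ.Integrable f ∧ g = (f : Germ μ.ae ℝ)} ∧
      (1 : Germ μ.ae ℝ) ∈ L1 ∧
      (∀ g h : L1, g * h = h * g) ∧
      IsRieszAlgebra L1 ∧
      (∀ f : L, (π f : Germ μ.ae ℝ) = ((f : X → ℝ) : Germ μ.ae ℝ)) ∧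
      IsRieszAlgebraHom π ∧
      -- the induced map is an injective Riesz algebra homomorphism
      (∀ f : L, J (π f) = I f) ∧
      IsRieszAlgebraHom J ∧
      Function.Injective J ∧
      (∀ g : L1, (JB g : A) = J g) ∧
      -- completeness and continuity properties
      SigmaDedekindComplete L1 ∧
      IsSigmaOrderContinuous J ∧
      IsSigmaOrderContinuous JB ∧
      (MonotoneComplete A → CountableSupProperty A →
        DedekindComplete L1 ∧ CountableSupProperty L1 ∧
        IsOrderContinuous J ∧ IsOrderContinuous JB) := by
  have hint := hasIntegral_iff hμ hμe hA hmul
  have hJ := isSigmaOrderContinuous_germIntegral (hμ := hμ) (hμe := hμe) (hA := hA) (hmul := hmul)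
  have hhom := isRieszAlgebraHom_germIntegral (hμ := hμ) (hμe := hμe) (hA := hA) (hmul := hmul)
  have hinj := injective_germIntegral (hμ := hμ) (hμe := hμe) (hA := hA) (hmul := hmul)
  have hL1 : SigmaDedekindComplete (integrableGerms hμ hμe hA hmul) :=
    sigmaDedekindComplete_integrableGerms
  have hπ := isRieszAlgebraHom_toIntegrableGerms hμ hμe hA hmul
  have hone : μ.Integrable (1 : X → ℝ) :=
    integrable_of_bounded hμ hA hmul measurable_const (C := 1) fun x => by simp
  have hp : μ univ ∈ hμ.corner hμe :=
    ((HasPosIntegral.indicator .univ).hasIntegral hμ hA hmul).mem_corner hμ hμe hA hmul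
  refine ⟨hμ.corner hμe, integrableFunctions hμ hμe hA hmul,
    germIntegral hμ hμe hA hmul ∘ₗ toIntegrableGerms hμ hμe hA hmul,
    germIntegralCorner hμ hμe hA hmul ∘ₗ toIntegrableGerms hμ hμe hA hmul,
    integrableGerms hμ hμe hA hmul, toIntegrableGerms hμ hμe hA hmul,
    germIntegral hμ hμe hA hmul, germIntegralCorner hμ hμe hA hmul,
    RieszSubalgebra.coe_corner, RieszSubalgebra.isRieszAlgebra _ hA.isRieszAlgebra,
    RieszSubalgebra.isProjectionBand_corner, rfl, hone,
    RieszSubalgebra.isRieszAlgebra _ (isRieszAlgebra_pi X), hint,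
    ⟨fun f g => ?_, fun f g => ?_, fun f g => ?_⟩, fun _ => rfl,
    ⟨⟨μ univ, hp⟩, rfl, ?_, fun f => ?_⟩, fun f => ?_, rfl, ⟨1, hone, rfl⟩,
    fun g h => Subtype.ext (mul_comm _ _),
    RieszSubalgebra.isRieszAlgebra _ (isRieszAlgebra_germ _ fun _ => μ.ae_all), fun _ => rfl, hπ,
    fun _ => rfl, hhom, hinj, fun _ => rfl, hL1, hJ, hJ.codRestrict fun _ => rfl, fun hM hC => ?_⟩
  · rw [LinearMap.comp_apply, hπ.map_mul, hhom.map_mul]; rfl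
  · rw [LinearMap.comp_apply, hπ.map_sup, hhom.map_sup]; rfl
  · rw [LinearMap.comp_apply, hπ.map_inf, hhom.map_inf]; rfl
  · rintro f hf ⟨C, hfC⟩
    have hf' := integrable_of_bounded hμ hA hmul hf hfC
    refine ⟨hf', Submodule.mem_sInf.2 fun I hI => ?_⟩
    exact ((hint ⟨f, hf'⟩ _).2 rfl).mem_of_isOrderIdeal (p := ⟨μ univ, hp⟩)
      (b := germIntegralCorner hμ hμe hA hmul (toIntegrableGerms hμ hμe hA hmul ⟨f, hf'⟩))
      hA hmul hI.1 rfl (hI.2 rfl) hfC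
  · refine Submodule.mem_sInf.2 fun I hI => ?_
    exact ((hint f _).2 rfl).mem_of_isSigmaOrderIdeal (p := ⟨μ univ, hp⟩)
      (b := germIntegralCorner hμ hμe hA hmul (toIntegrableGerms hμ hμe hA hmul f))
      hA hmul hI.1 rfl (hI.2 rfl)
  · exact ((hint f _).2 rfl).eq_zero_iff hμ hμe hA hmul
  -- Only the order structure of `L¹` and the embedding `J` enter from here on.
  · have hoc := isOrderContinuous_of_embedding hL1 hinj hhom.map_sup hJ hM hC
    exact ⟨dedekindComplete_of_embedding hL1 hinj hhom.map_sup hJ hM hC,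
      countableSupProperty_of_embedding hL1 hinj hhom.map_sup hJ hM hC, hoc,
      hoc.codRestrict fun _ => rfl⟩
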